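/- Let $\zeta$ be the Riemann zeta function, $\gamma$ Euler's constant, $H_n=\sum_{j=1}^n \frac1j$, and $B_m$ the Bernoulli numbers ($\frac{t}{e^t-1}=\sum_{m\ge0}B_m\frac{t^m}{m!}$, so $B_1=-\frac12$). For $z>0$ write $\mathcal L(f)(z)=\int_0^\infty e^{-xz}f(x)\,dx$. A series $\sum_{n\ge0}\frac{c_n}{z^{n+1}}$ is Borel summable for $z>0$ if $\sum_{n\ge0}c_n\frac{x^n}{n!}$ has a positive radius of convergence and its sum has an analytic continuation $g$ along $[0,\infty)$ such that $\int_0^\infty e^{-xz}g(x)\,dx$ converges for every $z>0$; its Borel sum is then $\sum^{\mathrm{Borel}}_{n\ge0}\frac{c_n}{z^{n+1}}=\int_0^\infty e^{-xz}g(x)\,dx$ (for a series starting at $n=1$ put $c_0=0$). Theorem. The series $\sum_{n\ge1}\frac{(-1)^{n+1}n!}{z^{n+1}}\zeta(n+1)$ is Borel summable for $z>0$, and for $0<z<\pi$ $$\sum_{k=0}^\infty\frac{z^k}{k!}\zeta'(-k)-\frac{\gamma}{z}+\sum_{n\ge1}^{\mathrm{Borel}}\frac{(-1)^{n+1}n!}{z^{n+1}}\zeta(n+1)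 =\frac{1}{e^z-1}\,\mathcal L\!\left(\frac1{x+1}\right)(z)-\sum_{k\ge0}\frac{z^k}{(k+1)!}\frac1{k+1}-\sum_{k\ge0}z^k\sum_{m=1}^{k}\frac{B_m}{m!}\frac{H_{k-m+1}}{(k-m+1)!}-\sum_{k\ge1}\frac{z^k}{k!}H_k\,\frac{1-B_{k+1}}{k+1},$$ where all the series in $k$ and the integral defining $\mathcal L\left(\frac1{x+1}\right)(z)$ converge absolutely. -/

import Mathlib

open Filter Topology

/-- The Laplace transform `𝓛(f)(z) = ∫₀^∞ e^{-xz} f(x) dx` of `f : [0, ∞) → ℂ` at a real point `z`. -/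
noncomputable def laplaceTransform (f : ℝ → ℂ) (z : ℝ) : ℂ :=
  ∫ x in Set.Ioi (0 : ℝ), Complex.exp (-(x * z : ℂ)) * f x

/-- The (possibly only conditionally) convergent integral `∫₀^∞ e^{-xw} g(x) dx` exists and
equals `S`. -/
def HasLaplaceIntegral (g : ℂ → ℂ) (w : ℝ) (S : ℂ) : Prop :=
  Tendsto (fun X : ℝ => ∫ x in (0 : ℝ)..X, Complex.exp (-(x * w : ℂ)) * g x) atTop (𝓝 S)

/-- `g` is an analytic continuation along `[0, ∞)` of the Borel transform `∑ cₙ xⁿ / n!`: this power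
series has a positive radius of convergence (part of `HasFPowerSeriesAt`), represents `g` near `0`,
and `g` is analytic at every point of the half-line. -/
def IsBorelTransform (c : ℕ → ℂ) (g : ℂ → ℂ) : Prop :=
  HasFPowerSeriesAt g
      (FormalMultilinearSeries.ofScalars ℂ fun n : ℕ => c n / (Nat.factorial n : ℂ)) 0 ∧
    ∀ x : ℝ, 0 ≤ x → AnalyticAt ℂ g (x : ℂ)

/-- The series `∑_{n ≥ 0} cₙ / z^{n+1}` is Borel summable (for positive `z`), and `S` is its Borel sum
at the point `z`. -/
def HasBorelSum (c : ℕ → ℂ) (z : ℝ) (S : ℂ) : Prop :=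
  ∃ g : ℂ → ℂ, IsBorelTransform c g ∧
    (∀ w : ℝ, 0 < w → ∃ T : ℂ, HasLaplaceIntegral g w T) ∧
    HasLaplaceIntegral g z S

/-- The Borel sum is well defined. -/
theorem HasBorelSum.unique {c : ℕ → ℂ} {z : ℝ} {S T : ℂ}
    (hS : HasBorelSum c z S) (hT : HasBorelSum c z T) : S = T := by
  obtain ⟨g, ⟨hg0, hg⟩, -, hgS⟩ := hS
  obtain ⟨h, ⟨hh0, hh⟩, -, hhT⟩ := hT
  have hpre : IsPreconnected ((fun x : ℝ => (x : ℂ)) '' Set.Ici 0) :=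
    isPreconnected_Ici.image _ Complex.continuous_ofReal.continuousOn
  have hEq : Set.EqOn g h ((fun x : ℝ => (x : ℂ)) '' Set.Ici 0) := by
    refine AnalyticOnNhd.eqOn_of_preconnected_of_eventuallyEq (𝕜 := ℂ) (z₀ := 0) ?_ ?_ hpre
      ⟨0, by simp, by simp⟩ ?_
    · rintro _ ⟨x, hx, rfl⟩
      exact hg x hx
    · rintro _ ⟨x, hx, rfl⟩
      exact hh x hx
    · filter_upwards [hg0.eventually_hasSum_sub, hh0.eventually_hasSum_sub] with y h1 h2
      exact h1.unique h2
  refine tendsto_nhds_unique (hgS.congr' ?_) hhT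
  filter_upwards [eventually_ge_atTop (0 : ℝ)] with X hX
  refine intervalIntegral.integral_congr fun x hx => ?_
  rw [Set.uIcc_of_le hX] at hx
  simp only [hEq ⟨x, hx.1, rfl⟩]

/-! The Borel transform is $g(x)=\sum_{n\ge1}(-1)^{n+1}\zeta(n+1)x^n=\psi(1+x)+\gamma$
(`digammaSeries`), which grows at most linearly on $[0,\infty)$, so the Borel sum is $G=\mathcal
L(g)$.

From $g(x+1)=g(x)+\frac1{x+1}$ one gets $(e^z-1)G(z)=\mathcal
L(\frac1{x+1})(z)+\int_0^1e^{(1-x)z}g(x)\,dx$ (`laplaceTransform_digammaSeries`). Expanding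
$\frac{ze^{(1-x)z}}{e^z-1}$ in Bernoulli polynomials turns the integral term of $G$ into
$\frac1z\sum_n M_nz^n$ with $M_n=\int_0^1\frac{B_n(1-x)}{n!}g(x)\,dx$ (`hasSum_digammaMoment`), and
$M_0=\gamma$ accounts for $\gamma/z$.

It remains to compare coefficients of $z^k$. Integration by parts expresses $M_{k+1}$ through the
Euler–Maclaurin remainder of order $k+2$ at $s=-k$ (`integral_scaledBernoulli_mul_digammaSeries`).
The same remainder is the only non-elementary part of $\zeta'(-k)/k!$ (`deriv_riemannZeta_neg`),
with the opposite sign. The sum of the two is therefore an explicit rational expression in Bernoulli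
and harmonic numbers (`deriv_riemannZeta_neg_add_digammaMoment`). -/

/-! ### Bernoulli polynomials divided by factorials. -/

/-- The Bernoulli polynomial `B_k(x) / k!`, as a complex-valued function on the real line. -/
noncomputable def scaledBernoulli (k : ℕ) (x : ℝ) : ℂ :=
  (bernoulliFun k x : ℂ) / (k.factorial : ℂ)

@[fun_prop]
lemma continuous_scaledBernoulli (k : ℕ) : Continuous (scaledBernoulli k) := by
  unfold scaledBernoulli
  fun_prop

lemma hasDerivAt_scaledBernoulli (k : ℕ) (x : ℝ) :
    HasDerivAt (scaledBernoulli (k + 1)) (scaledBernoulli k x) x := by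
  have h := ((hasDerivAt_bernoulliFun (k + 1) x).ofReal_comp).div_const ((k + 1).factorial : ℂ)
  refine h.congr_deriv ?_
  have h1 : (k.factorial : ℂ) ≠ 0 := by exact_mod_cast k.factorial_ne_zero
  have h2 : (k : ℂ) + 1 ≠ 0 := by exact_mod_cast k.succ_ne_zero
  simp only [scaledBernoulli, Nat.factorial_succ]
  push_cast
  field_simp

lemma scaledBernoulli_eval_zero (k : ℕ) :
    scaledBernoulli k 0 = (bernoulli k : ℂ) / (k.factorial : ℂ) := by
  simp [scaledBernoulli, bernoulliFun_eval_zero]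

lemma scaledBernoulli_eval_one (k : ℕ) :
    scaledBernoulli (k + 2) 1 = (bernoulli (k + 2) : ℂ) / ((k + 2).factorial : ℂ) := by
  simp [scaledBernoulli, bernoulliFun_eval_one, bernoulliFun_eval_zero]

lemma scaledBernoulli_one_sub (k : ℕ) (x : ℝ) :
    scaledBernoulli k (1 - x) = (-1) ^ k * scaledBernoulli k x := by
  simp [scaledBernoulli, bernoulliFun_eval_one_sub, mul_div_assoc]

lemma integral_scaledBernoulli (k : ℕ) :
    ∫ x in (0 : ℝ)..1, scaledBernoulli (k + 1) x = 0 := by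
  simp only [scaledBernoulli, intervalIntegral.integral_div, intervalIntegral.integral_ofReal,
    integral_bernoulliFun_eq_zero k.succ_ne_zero]
  simp

/-- For $k\ge2$ the Fourier series gives $(2\pi)^k|B_k(x)|/k!\le2\zeta(2)=\pi^2/3<4$; the constant 4
also covers $k=0,1$. This bound gives geometric convergence for $0<z<2\pi$ throughout. -/
lemma norm_scaledBernoulli_le (k : ℕ) {x : ℝ} (hx : x ∈ Set.Icc (0 : ℝ) 1) :
    ‖scaledBernoulli k x‖ ≤ 4 / (2 * Real.pi) ^ k := by
  have hpi := Real.pi_pos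
  match k with
  | 0 => simp [scaledBernoulli]
  | 1 =>
    have h1 : |x - 1 / 2| ≤ 1 / 2 := abs_le.2 ⟨by linarith [hx.1], by linarith [hx.2]⟩
    have h2 : ‖scaledBernoulli 1 x‖ = |x - 1 / 2| := by
      rw [scaledBernoulli, bernoulliFun_one, Nat.factorial_one, Nat.cast_one, div_one,
        Complex.norm_real, Real.norm_eq_abs]
    rw [h2, pow_one]
    refine h1.trans ?_
    rw [div_le_div_iff₀ (by norm_num) (by positivity)]
    linarith [Real.pi_le_four]
  | k + 2 =>
    have h := hasSum_one_div_nat_pow_mul_fourier (k := k + 2) (by omega) hx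
    have hz : HasSum (fun n : ℕ => 2 * ((1 : ℝ) / (n : ℝ) ^ 2)) (2 * (Real.pi ^ 2 / 6)) :=
      hasSum_zeta_two.mul_left 2
    have hb := tsum_of_norm_bounded hz (f := fun n : ℕ =>
        (1 : ℂ) / (n : ℂ) ^ (k + 2) * (fourier n (x : UnitAddCircle) +
          (-1 : ℂ) ^ (k + 2) * fourier (-n) (x : UnitAddCircle))) (fun n => by
      rcases Nat.eq_zero_or_pos n with rfl | hn
      · simp
      rw [norm_mul, mul_comm (2 : ℝ)]
      gcongr
      · rw [norm_div, norm_one, norm_pow, Complex.norm_natCast]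
        have : (1 : ℝ) ≤ n := by exact_mod_cast hn
        gcongr
        omega
      · refine (norm_add_le _ _).trans ?_
        rw [norm_mul, norm_pow, norm_neg, norm_one, one_pow, one_mul, fourier_apply, fourier_apply,
          Circle.norm_coe, Circle.norm_coe]
        norm_num)
    rw [h.tsum_eq] at hb
    have h3 : ‖-(2 * (Real.pi : ℂ) * Complex.I) ^ (k + 2) / ((k + 2).factorial : ℂ) *
        (bernoulliFun (k + 2) x : ℂ)‖ = (2 * Real.pi) ^ (k + 2) * ‖scaledBernoulli (k + 2) x‖ := by
      rw [scaledBernoulli, div_mul_eq_mul_div, mul_div_assoc, norm_mul, norm_neg, norm_pow]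
      simp [abs_of_pos hpi]
    rw [h3] at hb
    rw [le_div_iff₀ (by positivity), mul_comm]
    refine hb.trans ?_
    nlinarith [Real.pi_lt_d2]

/-! ### Euler–Maclaurin remainders. -/

/-- The integral of `B_K(x) / K!` against `(n + 1 + x)^{-w}` over the unit interval. -/
noncomputable def emTerm (K n : ℕ) (w : ℂ) : ℂ :=
  ∫ x in (0 : ℝ)..1, scaledBernoulli K x * ((n + 1 + x : ℝ) : ℂ) ^ (-w)

/-- The Euler–Maclaurin remainder of order `K` for the Riemann zeta function. -/
noncomputable def emRemainder (K : ℕ) (s : ℂ) : ℂ := ∑' n : ℕ, emTerm K n (s + K)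

lemma continuousOn_shift_cpow (n : ℕ) (w : ℂ) :
    ContinuousOn (fun x : ℝ => ((n + 1 + x : ℝ) : ℂ) ^ (-w)) (Set.uIcc 0 1) := by
  refine ContinuousOn.cpow_const (by fun_prop) fun x hx => ?_
  rw [Set.uIcc_of_le zero_le_one] at hx
  exact Complex.ofReal_mem_slitPlane.2 (by linarith [hx.1, (Nat.cast_nonneg n : (0 : ℝ) ≤ n)])

lemma hasDerivAt_shift_cpow (n : ℕ) (w : ℂ) {x : ℝ} (hx : 0 ≤ x) :
    HasDerivAt (fun x : ℝ => ((n + 1 + x : ℝ) : ℂ) ^ (-w))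
      (-w * ((n + 1 + x : ℝ) : ℂ) ^ (-(w + 1))) x := by
  have h0 : (0 : ℝ) < n + 1 + x := by positivity
  have h1 : HasDerivAt (fun x : ℝ => ((n + 1 + x : ℝ) : ℂ)) 1 x := by
    simpa using ((hasDerivAt_id x).const_add ((n : ℝ) + 1)).ofReal_comp
  have := (hasDerivAt_id ((n + 1 + x : ℝ) : ℂ)).cpow_const (c := -w)
    (Complex.ofReal_mem_slitPlane.2 h0)
  refine (this.comp x h1).congr_deriv ?_
  simp only [id_eq, mul_one]
  congr 2
  ring

/-- Integration by parts. The boundary values at 0 and 1 are kept apart because they differ when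
$K=0$: $B_1(0)=-\frac12$, $B_1(1)=\frac12$. -/
lemma emTerm_eq (K n : ℕ) (w : ℂ) :
    emTerm K n w = scaledBernoulli (K + 1) 1 * ((n + 2 : ℝ) : ℂ) ^ (-w)
      - scaledBernoulli (K + 1) 0 * ((n + 1 : ℝ) : ℂ) ^ (-w) + w * emTerm (K + 1) n (w + 1) := by
  have h := intervalIntegral.integral_deriv_mul_eq_sub (a := (0 : ℝ)) (b := 1)
    (u := scaledBernoulli (K + 1)) (u' := scaledBernoulli K)
    (v := fun x : ℝ => ((n + 1 + x : ℝ) : ℂ) ^ (-w))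
    (v' := fun x : ℝ => -w * ((n + 1 + x : ℝ) : ℂ) ^ (-(w + 1)))
    (fun x _ => hasDerivAt_scaledBernoulli K x)
    (fun x hx => hasDerivAt_shift_cpow n w (by rw [Set.uIcc_of_le zero_le_one] at hx; exact hx.1))
    ((continuous_scaledBernoulli K).intervalIntegrable _ _)
    (continuousOn_const.mul (continuousOn_shift_cpow n (w + 1))).intervalIntegrable
  have i1 : IntervalIntegrable (fun x : ℝ => scaledBernoulli K x * ((n + 1 + x : ℝ) : ℂ) ^ (-w))
      MeasureTheory.volume 0 1 := ((continuous_scaledBernoulli K).continuousOn.mul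
        (continuousOn_shift_cpow n w)).intervalIntegrable
  have i2 : IntervalIntegrable (fun x : ℝ => scaledBernoulli (K + 1) x *
      (-w * ((n + 1 + x : ℝ) : ℂ) ^ (-(w + 1)))) MeasureTheory.volume 0 1 :=
    ((continuous_scaledBernoulli (K + 1)).continuousOn.mul
      (continuousOn_const.mul (continuousOn_shift_cpow n (w + 1)))).intervalIntegrable
  rw [intervalIntegral.integral_add i1 i2] at h
  have h2 : ∫ x in (0 : ℝ)..1, scaledBernoulli (K + 1) x *
      (-w * ((n + 1 + x : ℝ) : ℂ) ^ (-(w + 1))) = -w * emTerm (K + 1) n (w + 1) := by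
    rw [emTerm, ← intervalIntegral.integral_const_mul]
    exact intervalIntegral.integral_congr fun x _ => by ring
  rw [h2, show (n + 1 + 1 : ℝ) = n + 2 by ring, add_zero] at h
  rw [emTerm]
  linear_combination h

lemma norm_shift_cpow_le (n : ℕ) {w : ℂ} (hw : 0 ≤ w.re) {x : ℝ} (hx : 0 ≤ x) :
    ‖((n + 1 + x : ℝ) : ℂ) ^ (-w)‖ ≤ (n + 1 : ℝ) ^ (-w.re) := by
  rw [Complex.norm_cpow_eq_rpow_re_of_pos (by positivity), Complex.neg_re]
  exact Real.rpow_le_rpow_of_nonpos (by positivity) (by linarith) (by linarith)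

lemma norm_emTerm_le (K n : ℕ) {w : ℂ} (hw : 0 ≤ w.re) :
    ‖emTerm K n w‖ ≤ 4 / (2 * Real.pi) ^ K * (n + 1 : ℝ) ^ (-w.re) := by
  have h := intervalIntegral.norm_integral_le_of_norm_le_const (a := (0 : ℝ)) (b := 1)
    (f := fun x : ℝ => scaledBernoulli K x * ((n + 1 + x : ℝ) : ℂ) ^ (-w))
    (C := 4 / (2 * Real.pi) ^ K * (n + 1 : ℝ) ^ (-w.re)) (fun x hx => by
      rw [Set.uIoc_of_le zero_le_one] at hx
      rw [norm_mul]
      have := Real.pi_pos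
      exact mul_le_mul (norm_scaledBernoulli_le K ⟨hx.1.le, hx.2⟩) (norm_shift_cpow_le n hw hx.1.le)
        (norm_nonneg _) (by positivity))
  simpa [emTerm] using h

lemma summable_add_one_rpow_neg {a : ℝ} (ha : 1 < a) :
    Summable fun n : ℕ => (n + 1 : ℝ) ^ (-a) := by
  have := (summable_nat_add_iff 1).2 (Real.summable_nat_rpow.2 (by linarith : -a < -1))
  simpa using this

lemma summable_emTerm (K : ℕ) {w : ℂ} (hw : 1 < w.re) : Summable fun n : ℕ => emTerm K n w :=
  Summable.of_norm_bounded ((summable_add_one_rpow_neg hw).mul_left _)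
    fun n => norm_emTerm_le K n (by linarith)

lemma differentiable_emTerm (K n : ℕ) : Differentiable ℂ (emTerm K n) := by
  intro w₀
  have hpos : ∀ x : ℝ, x ∈ Set.uIoc (0 : ℝ) 1 → 1 ≤ n + 1 + x ∧ n + 1 + x ≤ n + 2 := by
    intro x hx
    rw [Set.uIoc_of_le zero_le_one] at hx
    constructor <;> linarith [hx.1, hx.2, (Nat.cast_nonneg n : (0 : ℝ) ≤ n)]
  have hC : ∀ w : ℂ, ContinuousOn
      (fun x : ℝ => scaledBernoulli K x * ((n + 1 + x : ℝ) : ℂ) ^ (-w)) (Set.uIcc 0 1) :=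
    fun w => (continuous_scaledBernoulli K).continuousOn.mul (continuousOn_shift_cpow n w)
  have hC' : ContinuousOn (fun x : ℝ => scaledBernoulli K x *
      (((n + 1 + x : ℝ) : ℂ) ^ (-w₀) * Complex.log ((n + 1 + x : ℝ) : ℂ) * (-1)))
      (Set.uIcc 0 1) := by
    refine (continuous_scaledBernoulli K).continuousOn.mul
      (((continuousOn_shift_cpow n w₀).mul ?_).mul continuousOn_const)
    refine ContinuousOn.clog (by fun_prop) fun x hx => ?_
    rw [Set.uIcc_of_le zero_le_one] at hx
    exact Complex.ofReal_mem_slitPlane.2 (by linarith [hx.1, (Nat.cast_nonneg n : (0 : ℝ) ≤ n)])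
  have key := intervalIntegral.hasDerivAt_integral_of_dominated_loc_of_deriv_le
    (μ := MeasureTheory.volume) (a := (0 : ℝ)) (b := 1) (x₀ := w₀) (s := Metric.ball w₀ 1)
    (F := fun w x => scaledBernoulli K x * ((n + 1 + x : ℝ) : ℂ) ^ (-w))
    (F' := fun w x => scaledBernoulli K x *
      (((n + 1 + x : ℝ) : ℂ) ^ (-w) * Complex.log ((n + 1 + x : ℝ) : ℂ) * (-1)))
    -- On the unit ball about $w_0$ one has $-\mathrm{Re}\,w\le\|w_0\|+1$, and the base $n+1+x$ lies
    -- in $[1,n+2]$.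
    (bound := fun _ => 4 / (2 * Real.pi) ^ K *
      ((n + 2 : ℝ) ^ (‖w₀‖ + 1) * Real.log (n + 2)))
    (Metric.ball_mem_nhds _ one_pos)
    (Eventually.of_forall fun w =>
      ((hC w).mono Set.uIoc_subset_uIcc).aestronglyMeasurable measurableSet_uIoc)
    (hC w₀).intervalIntegrable
    ((hC'.mono Set.uIoc_subset_uIcc).aestronglyMeasurable measurableSet_uIoc)
    (Eventually.of_forall fun x hx w hw => ?_)
    intervalIntegrable_const
    (Eventually.of_forall fun x hx w hw => ?_)
  · exact key.2.differentiableAt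
  · obtain ⟨h1, h2⟩ := hpos x hx
    rw [Set.uIoc_of_le zero_le_one] at hx
    have hpi := Real.pi_pos
    have hw' : -w.re ≤ ‖w₀‖ + 1 := by
      have a1 : ‖w‖ ≤ ‖w₀‖ + 1 := by
        have := norm_sub_norm_le w w₀
        rw [mem_ball_iff_norm] at hw
        linarith
      linarith [neg_le_abs w.re, Complex.abs_re_le_norm w]
    rw [norm_mul]
    refine mul_le_mul (norm_scaledBernoulli_le K ⟨hx.1.le, hx.2⟩) ?_ (norm_nonneg _)
      (by positivity)
    rw [norm_mul, norm_neg, norm_one, mul_one, norm_mul]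
    refine mul_le_mul ?_ ?_ (norm_nonneg _) (by positivity)
    · rw [Complex.norm_cpow_eq_rpow_re_of_pos (by linarith), Complex.neg_re]
      exact (Real.rpow_le_rpow_of_exponent_le h1 hw').trans
        (Real.rpow_le_rpow (by linarith) h2 (by positivity))
    · rw [← Complex.ofReal_log (by linarith), Complex.norm_real, Real.norm_eq_abs,
        abs_of_nonneg (Real.log_nonneg h1)]
      exact Real.log_le_log (by linarith) h2
  · have h0 : ((n + 1 + x : ℝ) : ℂ) ≠ 0 := by
      exact_mod_cast (by linarith [(hpos x hx).1] : (n + 1 + x : ℝ) ≠ 0)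
    exact (((hasDerivAt_id w).neg).const_cpow (Or.inl h0)).const_mul _

lemma differentiableOn_emRemainder (K : ℕ) :
    DifferentiableOn ℂ (emRemainder K) {s : ℂ | 1 - (K : ℝ) < s.re} := by
  intro s hs
  -- On the smaller half-plane $\mathrm{Re}\,s>a$ the majorant $(n+1)^{-(a+K)}$ is uniform and
  -- summable.
  obtain ⟨a, ha1, ha2⟩ := exists_between (show 1 - (K : ℝ) < s.re from hs)
  have hU : IsOpen {s : ℂ | a < s.re} := isOpen_lt continuous_const Complex.continuous_re
  have := Complex.differentiableOn_tsum_of_summable_norm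
    (F := fun (n : ℕ) (s : ℂ) => emTerm K n (s + K)) (U := {s : ℂ | a < s.re})
    ((summable_add_one_rpow_neg (a := a + K) (by linarith)).mul_left (4 / (2 * Real.pi) ^ K))
    (fun n => ((differentiable_emTerm K n).comp (by fun_prop)).differentiableOn) hU
    (fun n w hw => by
      have hw' : a < w.re := hw
      have hre : (w + (K : ℂ)).re = w.re + K := by simp
      have hpi := Real.pi_pos
      refine (norm_emTerm_le K n (by rw [hre]; linarith)).trans ?_
      rw [hre]
      gcongr
      linarith [(Nat.cast_nonneg n : (0 : ℝ) ≤ n)])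
  exact ((this s ha2).differentiableAt (hU.mem_nhds ha2)).differentiableWithinAt

/-- Since $B_0=1$, the integrand is an exact derivative. This rewrites the telescoping boundary
terms as multiples of `emTerm 0`, whose sum is known. -/
lemma mul_emTerm_zero (n : ℕ) (w : ℂ) :
    w * emTerm 0 n (w + 1) = ((n + 1 : ℝ) : ℂ) ^ (-w) - ((n + 2 : ℝ) : ℂ) ^ (-w) := by
  have h := intervalIntegral.integral_eq_sub_of_hasDerivAt (a := (0 : ℝ)) (b := 1)
    (f := fun x : ℝ => ((n + 1 + x : ℝ) : ℂ) ^ (-w))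
    (f' := fun x : ℝ => -w * ((n + 1 + x : ℝ) : ℂ) ^ (-(w + 1)))
    (fun x hx => hasDerivAt_shift_cpow n w (by rw [Set.uIcc_of_le zero_le_one] at hx; exact hx.1))
    (continuousOn_const.mul (continuousOn_shift_cpow n (w + 1))).intervalIntegrable
  rw [intervalIntegral.integral_const_mul, show (n + 1 + 1 : ℝ) = n + 2 by ring, add_zero] at h
  simp only [emTerm, scaledBernoulli, bernoulliFun_zero, Nat.factorial_zero, Nat.cast_one,
    Complex.ofReal_one, div_one, one_mul]
  linear_combination -h

lemma tendsto_add_one_cpow_neg {w : ℂ} (hw : 0 < w.re) :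
    Tendsto (fun n : ℕ => ((n + 1 : ℝ) : ℂ) ^ (-w)) atTop (𝓝 0) := by
  rw [tendsto_zero_iff_norm_tendsto_zero]
  have h := (tendsto_rpow_neg_atTop hw).comp
    (tendsto_atTop_add_const_right atTop (1 : ℝ) tendsto_natCast_atTop_atTop)
  refine h.congr fun n => ?_
  rw [Complex.norm_cpow_eq_rpow_re_of_pos (by positivity), Complex.neg_re]
  rfl

lemma hasSum_mul_emTerm_zero {w : ℂ} (hw : 0 < w.re) :
    HasSum (fun n : ℕ => w * emTerm 0 n (w + 1)) 1 := by
  have hs : Summable fun n : ℕ => w * emTerm 0 n (w + 1) :=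
    (summable_emTerm 0 (by simpa using hw)).mul_left w
  rw [hs.hasSum_iff_tendsto_nat]
  have h : ∀ N : ℕ, ∑ n ∈ Finset.range N, w * emTerm 0 n (w + 1)
      = 1 - ((N + 1 : ℝ) : ℂ) ^ (-w) := by
    intro N
    induction N with
    | zero => simp
    | succ N ih =>
      rw [Finset.sum_range_succ, ih, mul_emTerm_zero, Nat.cast_add_one,
        show ((N : ℝ) + 1 + 1) = N + 2 by ring]
      ring
  simp_rw [h]
  simpa using (tendsto_add_one_cpow_neg hw).const_sub 1

/-- From order 1 on, the boundary values at 0 and 1 agree, so the boundary terms telescope.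
Integrating by parts gains one power of decay, which gives summability already for
$\mathrm{Re}\,w>0$. -/
lemma hasSum_emTerm_succ (K : ℕ) {w : ℂ} (hw : 0 < w.re) :
    HasSum (fun n : ℕ => emTerm (K + 1) n w)
      (-((bernoulli (K + 2) : ℂ) / ((K + 2).factorial : ℂ)) +
        w * ∑' n : ℕ, emTerm (K + 2) n (w + 1)) := by
  have h1 := (hasSum_mul_emTerm_zero hw).mul_left
    (-((bernoulli (K + 2) : ℂ) / ((K + 2).factorial : ℂ)))
  have h2 := ((summable_emTerm (K + 2) (w := w + 1) (by simpa using hw)).hasSum).mul_left w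
  rw [mul_one] at h1
  refine (h1.add h2).congr_fun fun n => ?_
  rw [mul_emTerm_zero, emTerm_eq (K + 1), scaledBernoulli_eval_zero, scaledBernoulli_eval_one]
  ring

lemma emRemainder_succ (K : ℕ) {s : ℂ} (hs : -(K : ℝ) - 1 < s.re) :
    emRemainder (K + 1) s = -((bernoulli (K + 2) : ℂ) / ((K + 2).factorial : ℂ)) +
      (s + (K + 1 : ℕ)) * emRemainder (K + 2) s := by
  have h := (hasSum_emTerm_succ K (w := s + (K + 1 : ℕ)) (by simp; linarith)).tsum_eq
  rw [emRemainder, h, emRemainder]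
  congr 3
  funext n
  congr 1
  push_cast
  ring

/-! ### The Euler–Maclaurin formula for zeta. -/

lemma riemannZeta₀_eq_emRemainder_one {s : ℂ} (hs : 1 < s.re) :
    riemannZeta₀ s = 1 / 2 - s * emRemainder 1 s := by
  have hs1 : s ≠ 1 := by
    rintro rfl
    simp at hs
  have hs2 : s - 1 ≠ 0 := sub_ne_zero.2 hs1
  have h0 := hasSum_mul_emTerm_zero (w := s - 1) (by simpa using hs)
  have hz : HasSum (fun n : ℕ => ((n + 1 : ℝ) : ℂ) ^ (-s)) (riemannZeta s) := by
    rw [zeta_eq_tsum_one_div_nat_add_one_cpow hs]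
    have hsum : Summable fun n : ℕ => ((n + 1 : ℝ) : ℂ) ^ (-s) :=
      Summable.of_norm_bounded (summable_add_one_rpow_neg hs) fun n => by
        simpa using norm_shift_cpow_le n (w := s) (by linarith) le_rfl
    convert hsum.hasSum using 3 with n
    rw [Complex.cpow_neg, one_div]
    push_cast
    rfl
  have hz' : HasSum (fun n : ℕ => ((n + 2 : ℝ) : ℂ) ^ (-s)) (riemannZeta s - 1) := by
    have := (hasSum_nat_add_iff' 1).2 hz
    simpa [add_assoc, one_add_one_eq_two] using this
  have hR := ((summable_emTerm 1 (w := s + 1) (by simp; linarith)).hasSum).mul_left s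
  -- Trapezoidal rule: the boundary terms of order 1 are half of $(n+1)^{-s}$ plus half of
  -- $(n+2)^{-s}$, and these sum to $\zeta(s)-\frac12$.
  have hsum := ((hz'.mul_left (1 / 2)).add (hz.mul_left (1 / 2))).add hR
  have heq : HasSum (fun n : ℕ => (s - 1) * emTerm 0 n (s - 1 + 1)) _ :=
    (hsum.mul_left (s - 1)).congr_fun fun n => by
      rw [sub_add_cancel, emTerm_eq 0, scaledBernoulli_eval_zero, zero_add, scaledBernoulli,
        bernoulliFun_one, bernoulli_one]
      push_cast
      norm_num
  have h1 := heq.unique h0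
  have h2 : (∑' n : ℕ, emTerm 1 n (s + 1)) = emRemainder 1 s := by simp [emRemainder]
  rw [h2] at h1
  have h3 := riemannZeta_eq_inv_sub_add hs1
  rw [h3] at h1
  field_simp at h1
  have h4 : (s - 1) * (riemannZeta₀ s - (1 / 2 - s * emRemainder 1 s)) = 0 := by
    linear_combination h1 / 2
  exact sub_eq_zero.1 ((mul_eq_zero.1 h4).resolve_left hs2)

lemma riemannZeta₀_eq_of_one_lt_re (K : ℕ) {s : ℂ} (hs : 1 < s.re) :
    riemannZeta₀ s = 1 / 2 + (∑ j ∈ Finset.range K,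
        (bernoulli (j + 2) : ℂ) / ((j + 2).factorial : ℂ) * (ascPochhammer ℂ (j + 1)).eval s)
      - (ascPochhammer ℂ (K + 1)).eval s * emRemainder (K + 1) s := by
  induction K with
  | zero => simpa using riemannZeta₀_eq_emRemainder_one hs
  | succ K ih =>
    have hK : (0 : ℝ) ≤ K := K.cast_nonneg
    rw [ih, Finset.sum_range_succ, emRemainder_succ K (by linarith),
      ascPochhammer_succ_eval (K + 1)]
    ring

/-- The Euler–Maclaurin formula for the Riemann zeta function, on the half-plane `Re s > -K`. -/
lemma riemannZeta₀_eq (K : ℕ) {s : ℂ} (hs : -(K : ℝ) < s.re) :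
    riemannZeta₀ s = 1 / 2 + (∑ j ∈ Finset.range K,
        (bernoulli (j + 2) : ℂ) / ((j + 2).factorial : ℂ) * (ascPochhammer ℂ (j + 1)).eval s)
      - (ascPochhammer ℂ (K + 1)).eval s * emRemainder (K + 1) s := by
  have hU : IsOpen {s : ℂ | -(K : ℝ) < s.re} := isOpen_lt continuous_const Complex.continuous_re
  have hconv : Convex ℝ {s : ℂ | -(K : ℝ) < s.re} := convex_halfSpace_re_gt _
  have hd : DifferentiableOn ℂ (emRemainder (K + 1)) {s : ℂ | -(K : ℝ) < s.re} :=
    (differentiableOn_emRemainder (K + 1)).mono fun w hw => by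
      have : -(K : ℝ) < w.re := hw
      show 1 - ((K + 1 : ℕ) : ℝ) < w.re
      push_cast
      linarith
  have hp : ∀ m : ℕ, DifferentiableOn ℂ (fun s => (ascPochhammer ℂ m).eval s)
      {s : ℂ | -(K : ℝ) < s.re} := fun m => (Polynomial.differentiable _).differentiableOn
  have hK : (0 : ℝ) ≤ K := K.cast_nonneg
  -- Identity theorem: both sides are analytic on a convex half-plane and agree near $s=2$.
  refine AnalyticOnNhd.eqOn_of_preconnected_of_eventuallyEq (𝕜 := ℂ) (z₀ := 2)
    (f := riemannZeta₀) (differentiable_riemannZeta₀.differentiableOn.analyticOnNhd hU)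
    (g := fun s => 1 / 2 + (∑ j ∈ Finset.range K,
        (bernoulli (j + 2) : ℂ) / ((j + 2).factorial : ℂ) * (ascPochhammer ℂ (j + 1)).eval s)
      - (ascPochhammer ℂ (K + 1)).eval s * emRemainder (K + 1) s)
    (DifferentiableOn.analyticOnNhd ?_ hU) hconv.isPreconnected ?_ ?_ hs
  · refine DifferentiableOn.sub (DifferentiableOn.add (differentiableOn_const _)
      (DifferentiableOn.fun_sum fun j _ => (hp _).const_mul _)) ((hp _).mul hd)
  · show -(K : ℝ) < (2 : ℂ).re
    simp
    linarith
  · have : {s : ℂ | 1 < s.re} ∈ 𝓝 (2 : ℂ) :=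
      (isOpen_lt continuous_const Complex.continuous_re).mem_nhds (by simp)
    filter_upwards [this] with s hs using riemannZeta₀_eq_of_one_lt_re K hs

/-! ### The values of $\zeta'$ at nonpositive integers. -/

lemma ascPochhammer_eval_neg {k m : ℕ} (hm : m ≤ k) :
    (ascPochhammer ℂ m).eval (-(k : ℂ)) =
      (-1) ^ m * (k.factorial : ℂ) / ((k - m).factorial : ℂ) := by
  induction m with
  | zero => simp [Nat.factorial_ne_zero]
  | succ m ih =>
    obtain ⟨d, rfl⟩ := Nat.exists_eq_add_of_le hm
    rw [ascPochhammer_succ_eval, ih (by omega), show m + 1 + d - m = d + 1 by omega,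
      show m + 1 + d - (m + 1) = d by omega, Nat.factorial_succ d]
    have h1 : (d.factorial : ℂ) ≠ 0 := by exact_mod_cast d.factorial_ne_zero
    have h2 : (d : ℂ) + 1 ≠ 0 := by exact_mod_cast d.succ_ne_zero
    push_cast
    field_simp
    ring

/-- The logarithmic derivative of $s(s+1)\cdots(s+m-1)$ at $-k$ is
$-\sum_{i<m}\frac1{k-i}=-(H_k-H_{k-m})$. -/
lemma hasDerivAt_ascPochhammer_neg {k m : ℕ} (hm : m ≤ k) :
    HasDerivAt (fun s => (ascPochhammer ℂ m).eval s)
      ((-1) ^ (m + 1) * (k.factorial : ℂ) / ((k - m).factorial : ℂ) *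
        ((harmonic k : ℂ) - (harmonic (k - m) : ℂ))) (-(k : ℂ)) := by
  induction m with
  | zero => simpa using hasDerivAt_const (-(k : ℂ)) (1 : ℂ)
  | succ m ih =>
    have h := (ih (by omega)).mul ((hasDerivAt_id (-(k : ℂ))).add_const (m : ℂ))
    simp only [ascPochhammer_succ_eval]
    refine h.congr_deriv ?_
    simp only [id]
    rw [ascPochhammer_eval_neg (by omega)]
    obtain ⟨d, rfl⟩ := Nat.exists_eq_add_of_le hm
    rw [show m + 1 + d - m = d + 1 by omega,
      show m + 1 + d - (m + 1) = d by omega, Nat.factorial_succ d, harmonic_succ d]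
    have h1 : (d.factorial : ℂ) ≠ 0 := by exact_mod_cast d.factorial_ne_zero
    have h2 : (d : ℂ) + 1 ≠ 0 := by exact_mod_cast d.succ_ne_zero
    push_cast
    field_simp
    ring

lemma hasDerivAt_ascPochhammer_succ_neg (k : ℕ) :
    HasDerivAt (fun s => (ascPochhammer ℂ (k + 1)).eval s)
      ((-1) ^ k * (k.factorial : ℂ)) (-(k : ℂ)) := by
  have h := (hasDerivAt_ascPochhammer_neg (le_refl k)).mul
    ((hasDerivAt_id (-(k : ℂ))).add_const (k : ℂ))
  simp only [ascPochhammer_succ_eval]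
  refine h.congr_deriv ?_
  simp [ascPochhammer_eval_neg]

lemma ascPochhammer_succ_eval_neg (k : ℕ) : (ascPochhammer ℂ (k + 1)).eval (-(k : ℂ)) = 0 := by
  simp [ascPochhammer_succ_eval]

/-- In Euler–Maclaurin the remainder is multiplied by the rising factorial of length $k+2$, which
vanishes at $-k$; differentiating the product therefore leaves the value of the remainder but not
its derivative. -/
lemma deriv_riemannZeta_neg (k : ℕ) :
    deriv riemannZeta (-(k : ℂ)) = -1 / ((k : ℂ) + 1) ^ 2 +
      (∑ j ∈ Finset.range k, (bernoulli (j + 2) : ℂ) / ((j + 2).factorial : ℂ) *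
        ((-1) ^ j * (k.factorial : ℂ) / ((k - (j + 1)).factorial : ℂ) *
          ((harmonic k : ℂ) - (harmonic (k - (j + 1)) : ℂ)))) +
      (-1) ^ k * (k.factorial : ℂ) * ((bernoulli (k + 2) : ℂ) / ((k + 2).factorial : ℂ)
        - emRemainder (k + 2) (-(k : ℂ))) := by
  have hk : (k : ℂ) + 1 ≠ 0 := by exact_mod_cast k.succ_ne_zero
  have hk1 : (-(k : ℂ)) - 1 ≠ 0 := by
    intro h
    exact hk (by linear_combination -h)
  have hU : {s : ℂ | -((k + 1 : ℕ) : ℝ) < s.re} ∈ 𝓝 (-(k : ℂ)) :=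
    (isOpen_lt continuous_const Complex.continuous_re).mem_nhds (by simp)
  have hev : riemannZeta =ᶠ[𝓝 (-(k : ℂ))] fun s => (s - 1)⁻¹ + (1 / 2 +
      (∑ j ∈ Finset.range (k + 1), (bernoulli (j + 2) : ℂ) / ((j + 2).factorial : ℂ) *
        (ascPochhammer ℂ (j + 1)).eval s)
      - (ascPochhammer ℂ (k + 1 + 1)).eval s * emRemainder (k + 1 + 1) s) := by
    filter_upwards [hU, isOpen_ne.mem_nhds (sub_ne_zero.1 hk1)] with s hs hs1
    rw [riemannZeta_eq_inv_sub_add hs1, riemannZeta₀_eq (k + 1) hs]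
  have hR : DifferentiableAt ℂ (emRemainder (k + 2)) (-(k : ℂ)) := by
    refine (differentiableOn_emRemainder (k + 2)).differentiableAt ?_
    refine (isOpen_lt continuous_const Complex.continuous_re).mem_nhds ?_
    simp
    linarith
  have hP : HasDerivAt (fun s => (ascPochhammer ℂ (k + 2)).eval s)
      ((-1) ^ k * (k.factorial : ℂ)) (-(k : ℂ)) := by
    have h := (hasDerivAt_ascPochhammer_succ_neg k).mul
      ((hasDerivAt_id (-(k : ℂ))).add_const ((k + 1 : ℕ) : ℂ))
    simp only [ascPochhammer_succ_eval (k + 1)]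
    refine h.congr_deriv ?_
    simp [ascPochhammer_succ_eval_neg]
  have hP0 : (ascPochhammer ℂ (k + 2)).eval (-(k : ℂ)) = 0 := by
    rw [ascPochhammer_succ_eval, ascPochhammer_succ_eval_neg, zero_mul]
  have hS : HasDerivAt (fun s => ∑ j ∈ Finset.range k,
      (bernoulli (j + 2) : ℂ) / ((j + 2).factorial : ℂ) * (ascPochhammer ℂ (j + 1)).eval s)
      (∑ j ∈ Finset.range k, (bernoulli (j + 2) : ℂ) / ((j + 2).factorial : ℂ) *
        ((-1) ^ (j + 1 + 1) * (k.factorial : ℂ) / ((k - (j + 1)).factorial : ℂ) *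
          ((harmonic k : ℂ) - (harmonic (k - (j + 1)) : ℂ)))) (-(k : ℂ)) := by
    refine HasDerivAt.fun_sum fun j hj => ?_
    exact (hasDerivAt_ascPochhammer_neg (Finset.mem_range.1 hj)).const_mul _
  have hinv : HasDerivAt (fun s : ℂ => (s - 1)⁻¹) (-1 / (-(k : ℂ) - 1) ^ 2) (-(k : ℂ)) := by
    exact ((hasDerivAt_id (-(k : ℂ))).sub_const 1).inv hk1
  -- The summand $j=k$ is split off: its rising factorial has a zero at $-k$, so the harmonic-number
  -- formula for the derivative does not apply to it.
  simp only [Finset.sum_range_succ] at hev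
  have htot := hinv.add (((hS.add ((hasDerivAt_ascPochhammer_succ_neg k).const_mul
    ((bernoulli (k + 2) : ℂ) / ((k + 2).factorial : ℂ)))).const_add (1 / 2)).sub
      (hP.mul hR.hasDerivAt))
  rw [hev.deriv_eq]
  refine htot.deriv.trans ?_
  rw [hP0, show (-(k : ℂ) - 1) ^ 2 = ((k : ℂ) + 1) ^ 2 by ring]
  simp only [pow_succ, mul_neg, mul_one, neg_neg]
  ring

/-! ### The Borel transform. -/

/-- The function `x ↦ ψ(1 + x) + γ`, as a series of partial fractions. -/
noncomputable def digammaSeries (x : ℂ) : ℂ := ∑' n : ℕ, (1 / ((n : ℂ) + 1) - 1 / ((n : ℂ) + 1 + x))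

/-- The half-plane $\mathrm{Re}\,x\ge-\frac12$ contains a neighbourhood of $[0,\infty)$ and the disc
of radius $\frac12$ used for the power series, and stays away from the poles $-1,-2,\dots$ -/
lemma half_le_norm_add {x : ℂ} (hx : -(1 / 2) ≤ x.re) (n : ℕ) :
    ((n : ℝ) + 1) / 2 ≤ ‖(n : ℂ) + 1 + x‖ := by
  have h := Complex.re_le_norm ((n : ℂ) + 1 + x)
  simp only [Complex.add_re, Complex.natCast_re, Complex.one_re] at h
  linarith [(Nat.cast_nonneg n : (0 : ℝ) ≤ n)]

lemma add_one_add_ne_zero {x : ℂ} (hx : -(1 / 2) ≤ x.re) (n : ℕ) : (n : ℂ) + 1 + x ≠ 0 := by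
  have h := half_le_norm_add hx n
  refine norm_pos_iff.1 (lt_of_lt_of_le ?_ h)
  positivity

lemma norm_digammaSeries_term_le {x : ℂ} (hx : -(1 / 2) ≤ x.re) (n : ℕ) :
    ‖1 / ((n : ℂ) + 1) - 1 / ((n : ℂ) + 1 + x)‖ ≤ 2 * ‖x‖ * (1 / ((n : ℝ) + 1) ^ 2) := by
  have h := half_le_norm_add hx n
  have h0 := add_one_add_ne_zero hx n
  have h1 : (n : ℂ) + 1 ≠ 0 := by exact_mod_cast n.succ_ne_zero
  have h2 : 1 / ((n : ℂ) + 1) - 1 / ((n : ℂ) + 1 + x) =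
      x / (((n : ℂ) + 1) * ((n : ℂ) + 1 + x)) := by
    field_simp
    ring
  have h3 : ‖(n : ℂ) + 1‖ = (n : ℝ) + 1 := by
    rw [← Nat.cast_add_one, Complex.norm_natCast, Nat.cast_add_one]
  rw [h2, norm_div, norm_mul, h3, div_le_iff₀ (by positivity)]
  calc ‖x‖ = 2 * ‖x‖ * (1 / ((n : ℝ) + 1) ^ 2) * (((n : ℝ) + 1) * (((n : ℝ) + 1) / 2)) := by
        field_simp
    _ ≤ _ := by gcongr

lemma hasSum_one_div_add_one_sq :
    HasSum (fun n : ℕ => 1 / ((n : ℝ) + 1) ^ 2) (Real.pi ^ 2 / 6) := by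
  have := (hasSum_nat_add_iff' 1).2 hasSum_zeta_two
  simpa using this

lemma summable_digammaSeries {x : ℂ} (hx : -(1 / 2) ≤ x.re) :
    Summable fun n : ℕ => (1 / ((n : ℂ) + 1) - 1 / ((n : ℂ) + 1 + x)) :=
  Summable.of_norm_bounded (hasSum_one_div_add_one_sq.summable.mul_left _)
    (norm_digammaSeries_term_le hx)

lemma norm_digammaSeries_le {x : ℂ} (hx : -(1 / 2) ≤ x.re) :
    ‖digammaSeries x‖ ≤ 4 * ‖x‖ := by
  refine (tsum_of_norm_bounded (hasSum_one_div_add_one_sq.mul_left (2 * ‖x‖))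
    (norm_digammaSeries_term_le hx)).trans ?_
  have : Real.pi ^ 2 / 6 ≤ 2 := by nlinarith [Real.pi_lt_d2, Real.pi_pos]
  nlinarith [norm_nonneg x]

lemma analyticAt_digammaSeries {x : ℂ} (hx : -(1 / 2) < x.re) : AnalyticAt ℂ digammaSeries x := by
  -- The bound on the terms grows with $\|x\|$, so uniformity requires a bounded region.
  set U : Set ℂ := {y | -(1 / 2) < y.re} ∩ {y | ‖y‖ < ‖x‖ + 1} with hUdef
  have hU : IsOpen U := (isOpen_lt continuous_const Complex.continuous_re).inter
    (isOpen_lt continuous_norm continuous_const)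
  have hxU : x ∈ U := ⟨hx, by simp⟩
  have hd : DifferentiableOn ℂ digammaSeries U := by
    refine Complex.differentiableOn_tsum_of_summable_norm
      (hasSum_one_div_add_one_sq.summable.mul_left (2 * (‖x‖ + 1))) (fun n y hy => ?_) hU
      (fun n y hy => ?_)
    · have h0 := add_one_add_ne_zero (le_of_lt hy.1) n
      have : DifferentiableAt ℂ (fun y : ℂ => 1 / ((n : ℂ) + 1) - 1 / ((n : ℂ) + 1 + y)) y := by
        fun_prop (disch := assumption)
      exact this.differentiableWithinAt
    · refine (norm_digammaSeries_term_le (le_of_lt hy.1) n).trans ?_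
      have : ‖y‖ ≤ ‖x‖ + 1 := le_of_lt hy.2
      gcongr
  exact hd.analyticAt (hU.mem_nhds hxU)

lemma digammaSeries_add_one {x : ℂ} (hx : 0 ≤ x.re) :
    digammaSeries (x + 1) = digammaSeries x + 1 / (x + 1) := by
  have h1 := summable_digammaSeries (x := x) (by linarith)
  have h2 := summable_digammaSeries (x := x + 1) (by simp; linarith)
  have hd := h2.hasSum.sub h1.hasSum
  have ht : Tendsto (fun n : ℕ => 1 / ((n : ℂ) + 1 + x)) atTop (𝓝 0) := by
    rw [tendsto_zero_iff_norm_tendsto_zero]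
    have hlim : Tendsto (fun n : ℕ => 2 * (1 / ((n : ℝ) + 1))) atTop (𝓝 0) := by
      simpa using tendsto_one_div_add_atTop_nhds_zero_nat.const_mul (2 : ℝ)
    refine squeeze_zero (fun n => norm_nonneg _) (fun n => ?_) hlim
    have := half_le_norm_add (x := x) (by linarith) n
    rw [norm_div, norm_one]
    calc 1 / ‖(n : ℂ) + 1 + x‖ ≤ 1 / (((n : ℝ) + 1) / 2) := by gcongr
      _ = _ := by field_simp
  have hs : ∀ N : ℕ, ∑ n ∈ Finset.range N, ((1 / ((n : ℂ) + 1) - 1 / ((n : ℂ) + 1 + (x + 1))) -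
      (1 / ((n : ℂ) + 1) - 1 / ((n : ℂ) + 1 + x))) = 1 / (x + 1) - 1 / ((N : ℂ) + 1 + x) := by
    intro N
    induction N with
    | zero => simp [add_comm]
    | succ N ih =>
      rw [Finset.sum_range_succ, ih]
      push_cast
      rw [show (N : ℂ) + 1 + (x + 1) = N + 1 + 1 + x by ring]
      ring
  have hlim := hd.tendsto_sum_nat
  simp_rw [hs] at hlim
  have := tendsto_nhds_unique hlim (ht.const_sub (1 / (x + 1)))
  rw [digammaSeries, digammaSeries]
  linear_combination this

lemma hasSum_zeta_add_two (n : ℕ) :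
    HasSum (fun j : ℕ => 1 / ((j : ℂ) + 1) ^ (n + 2)) (riemannZeta ((n : ℂ) + 2)) := by
  have hs : Summable fun j : ℕ => 1 / ((j : ℂ) + 1) ^ (n + 2) := by
    have h := (summable_nat_add_iff 1).2 (Real.summable_one_div_nat_pow.2 (by omega : 1 < n + 2))
    have h' : Summable fun j : ℕ => ((1 / ((j + 1 : ℕ) : ℝ) ^ (n + 2) : ℝ) : ℂ) := by
      exact_mod_cast h
    simpa using h'
  have h := zeta_eq_tsum_one_div_nat_add_one_cpow (s := (n : ℂ) + 2) (by
    simp only [Complex.add_re, Complex.natCast_re, Complex.re_ofNat]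
    linarith [(Nat.cast_nonneg n : (0 : ℝ) ≤ n)])
  rw [h]
  convert hs.hasSum using 4 with j
  rw [← Complex.cpow_natCast]
  push_cast
  rfl

/-- Each partial fraction is expanded as a geometric series in $-y/(j+1)$; the double series
converges absolutely, and summing over $j$ first produces the zeta values. -/
lemma hasSum_digammaSeries {y : ℂ} (hy : ‖y‖ < 1 / 2) :
    HasSum (fun n : ℕ => (-1) ^ n * y ^ (n + 1) * riemannZeta ((n : ℂ) + 2)) (digammaSeries y) := by
  have hre : -(1 / 2) ≤ y.re := by linarith [neg_abs_le y.re, Complex.abs_re_le_norm y]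
  have hF : Summable fun p : ℕ × ℕ =>
      (-1) ^ p.1 * y ^ (p.1 + 1) * (1 / ((p.2 : ℂ) + 1) ^ (p.1 + 2)) := by
    have hg : Summable fun n : ℕ => ‖y‖ ^ n * ‖y‖ :=
      (summable_geometric_of_lt_one (norm_nonneg y) (by linarith)).mul_right _
    refine Summable.of_norm_bounded (hg.mul_of_nonneg hasSum_one_div_add_one_sq.summable
      (fun n => by positivity) (fun n => by positivity)) fun p => ?_
    have h3 : ‖(p.2 : ℂ) + 1‖ = (p.2 : ℝ) + 1 := by
      rw [← Nat.cast_add_one, Complex.norm_natCast, Nat.cast_add_one]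
    rw [norm_mul, norm_mul, norm_div, norm_pow, norm_pow, norm_pow, norm_neg, norm_one, one_pow,
      one_mul, h3, pow_succ]
    gcongr
    · linarith [(Nat.cast_nonneg p.2 : (0 : ℝ) ≤ p.2)]
    · omega
  have h1 : HasSum (fun n : ℕ => (-1) ^ n * y ^ (n + 1) * riemannZeta ((n : ℂ) + 2))
      (∑' p : ℕ × ℕ, (-1) ^ p.1 * y ^ (p.1 + 1) * (1 / ((p.2 : ℂ) + 1) ^ (p.1 + 2))) :=
    hF.hasSum.prod_fiberwise fun n => (hasSum_zeta_add_two n).mul_left ((-1) ^ n * y ^ (n + 1))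
  have hterm : ∀ j : ℕ, HasSum
      (fun n : ℕ => (-1) ^ n * y ^ (n + 1) * (1 / ((j : ℂ) + 1) ^ (n + 2)))
      (1 / ((j : ℂ) + 1) - 1 / ((j : ℂ) + 1 + y)) := by
    intro j
    have hj : (j : ℂ) + 1 ≠ 0 := by exact_mod_cast j.succ_ne_zero
    have hjy := add_one_add_ne_zero hre j
    have hn : ‖-y / ((j : ℂ) + 1)‖ < 1 := by
      have h3 : ‖(j : ℂ) + 1‖ = (j : ℝ) + 1 := by
        rw [← Nat.cast_add_one, Complex.norm_natCast, Nat.cast_add_one]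
      rw [norm_div, norm_neg, h3, div_lt_one (by positivity)]
      linarith [(Nat.cast_nonneg j : (0 : ℝ) ≤ j)]
    have hgeo := (hasSum_geometric_of_norm_lt_one hn).mul_left (y / ((j : ℂ) + 1) ^ 2)
    have hval : y / ((j : ℂ) + 1) ^ 2 * (1 - -y / ((j : ℂ) + 1))⁻¹ =
        1 / ((j : ℂ) + 1) - 1 / ((j : ℂ) + 1 + y) := by
      rw [show 1 - -y / ((j : ℂ) + 1) = ((j : ℂ) + 1 + y) / ((j : ℂ) + 1) by
        field_simp
        ring]
      field_simp
      ring
    rw [hval] at hgeo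
    refine hgeo.congr_fun fun n => ?_
    rw [div_pow, neg_pow y, pow_add _ n 2, pow_succ y n]
    field_simp
  have hswap : Summable fun p : ℕ × ℕ =>
      (-1) ^ p.2 * y ^ (p.2 + 1) * (1 / ((p.1 : ℂ) + 1) ^ (p.2 + 2)) :=
    (Equiv.prodComm ℕ ℕ).summable_iff.1 hF
  have h2 := hswap.hasSum.prod_fiberwise hterm
  have h3 : ∑' p : ℕ × ℕ, (-1) ^ p.2 * y ^ (p.2 + 1) * (1 / ((p.1 : ℂ) + 1) ^ (p.2 + 2)) =
      ∑' p : ℕ × ℕ, (-1) ^ p.1 * y ^ (p.1 + 1) * (1 / ((p.2 : ℂ) + 1) ^ (p.1 + 2)) :=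
    ((Equiv.prodComm ℕ ℕ).tsum_eq fun p : ℕ × ℕ =>
      (-1) ^ p.1 * y ^ (p.1 + 1) * (1 / ((p.2 : ℂ) + 1) ^ (p.1 + 2)))
  rw [digammaSeries, h2.tsum_eq, h3]
  exact h1

lemma isBorelTransform_digammaSeries :
    IsBorelTransform (fun n : ℕ => if n = 0 then 0 else
      (-1) ^ (n + 1) * (Nat.factorial n : ℂ) * riemannZeta ((n : ℂ) + 1)) digammaSeries := by
  refine ⟨⟨ENNReal.ofReal (1 / 2), ?_⟩, fun x hx => analyticAt_digammaSeries (by simp; linarith)⟩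
  have hsum : ∀ y : ℂ, ‖y‖ < 1 / 2 → HasSum (fun n : ℕ =>
      (FormalMultilinearSeries.ofScalars ℂ fun n : ℕ => (if n = 0 then 0 else
        (-1) ^ (n + 1) * (Nat.factorial n : ℂ) * riemannZeta ((n : ℂ) + 1)) /
          (Nat.factorial n : ℂ)) n fun _ => y) (digammaSeries y) := by
    intro y hy
    rw [← hasSum_nat_add_iff' 1]
    simp only [FormalMultilinearSeries.ofScalars_apply_eq, Finset.range_one, Finset.sum_singleton,
      if_true, zero_div, zero_smul, sub_zero]
    refine (hasSum_digammaSeries hy).congr_fun fun n => ?_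
    have : ((n + 1).factorial : ℂ) ≠ 0 := by exact_mod_cast (n + 1).factorial_ne_zero
    rw [if_neg n.succ_ne_zero, smul_eq_mul]
    push_cast
    rw [show (n : ℂ) + 1 + 1 = n + 2 by ring]
    field_simp
    ring
  refine ⟨?_, by simp, fun {y} hy => ?_⟩
  -- For each real $r<\frac12$ the series converges at $r$, so its terms tend to 0, which bounds the
  -- radius of convergence from below.
  · refine ENNReal.le_of_forall_nnreal_lt fun r hr => ?_
    have hr' : (r : ℝ) < 1 / 2 := by
      rwa [← ENNReal.ofReal_coe_nnreal, ENNReal.ofReal_lt_ofReal_iff (by norm_num)] at hr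
    have h := (hsum (r : ℝ) (by simpa using hr')).summable.tendsto_atTop_zero.norm
    refine FormalMultilinearSeries.le_radius_of_tendsto _ (l := 0) ?_
    rw [norm_zero] at h
    refine h.congr fun n => ?_
    rw [FormalMultilinearSeries.ofScalars_apply_eq, norm_smul,
      FormalMultilinearSeries.ofScalars_norm, norm_pow]
    simp
  · rw [zero_add]
    refine hsum y ?_
    rw [Metric.mem_eball, edist_zero_right, ← ofReal_norm,
      ENNReal.ofReal_lt_ofReal_iff (by norm_num)] at hy
    exact hy

lemma continuousOn_digammaSeries : ContinuousOn (fun x : ℝ => digammaSeries x) (Set.Ici 0) := by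
  intro x hx
  have hx' : (0 : ℝ) ≤ x := hx
  have h := (analyticAt_digammaSeries (x := (x : ℂ)) (by simp; linarith)).continuousAt
  exact (ContinuousAt.comp (f := fun x : ℝ => (x : ℂ)) h
    Complex.continuous_ofReal.continuousAt).continuousWithinAt

lemma continuousOn_digammaSeries_uIcc :
    ContinuousOn (fun x : ℝ => digammaSeries x) (Set.uIcc 0 1) :=
  continuousOn_digammaSeries.mono fun x hx => by
    rw [Set.uIcc_of_le zero_le_one] at hx
    exact hx.1

/-! ### Moments of the Borel transform against Bernoulli polynomials. -/

lemma hasSum_integral_mul_digammaSeries {h : ℝ → ℂ} (hc : Continuous h) :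
    HasSum (fun n : ℕ => ∫ x in (0 : ℝ)..1, h x * (1 / ((n : ℂ) + 1) - 1 / ((n : ℂ) + 1 + x)))
      (∫ x in (0 : ℝ)..1, h x * digammaSeries x) := by
  obtain ⟨C, hC⟩ := (isCompact_Icc (a := (0 : ℝ)) (b := 1)).exists_bound_of_continuousOn
    hc.continuousOn
  have hre : ∀ x : ℝ, x ∈ Set.uIoc (0 : ℝ) 1 → x ∈ Set.Icc (0 : ℝ) 1 := fun x hx => by
    rw [Set.uIoc_of_le zero_le_one] at hx
    exact ⟨hx.1.le, hx.2⟩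
  have hC0 : 0 ≤ C := (norm_nonneg _).trans (hC 0 ⟨le_rfl, zero_le_one⟩)
  have hsum : Summable fun n : ℕ => C * (2 * (1 / ((n : ℝ) + 1) ^ 2)) :=
    (hasSum_one_div_add_one_sq.summable.mul_left 2).mul_left C
  refine intervalIntegral.hasSum_integral_of_dominated_convergence
    (fun n _ => C * (2 * (1 / ((n : ℝ) + 1) ^ 2))) (fun n => ?_)
    (fun n => Eventually.of_forall fun x hx => ?_) (Eventually.of_forall fun x _ => hsum)
    intervalIntegrable_const (Eventually.of_forall fun x hx => ?_)
  · refine ContinuousOn.aestronglyMeasurable ?_ measurableSet_uIoc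
    refine hc.continuousOn.mul (continuousOn_const.sub (continuousOn_const.div (by fun_prop) ?_))
    exact fun x hx => add_one_add_ne_zero (by simp; linarith [(hre x hx).1]) n
  · obtain ⟨h0, h1⟩ := hre x hx
    rw [norm_mul]
    refine mul_le_mul (hC x ⟨h0, h1⟩) ?_ (norm_nonneg _) hC0
    refine (norm_digammaSeries_term_le (by simp; linarith) n).trans ?_
    have : ‖(x : ℂ)‖ ≤ 1 := by rwa [Complex.norm_real, Real.norm_eq_abs, abs_of_nonneg h0]
    gcongr
    linarith
  · exact (summable_digammaSeries (by simp; linarith [(hre x hx).1])).hasSum.mul_left _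

/-- Since $B_{k+1}$ has mean zero on $[0,1]$, the constants $\frac1{n+1}$ drop out and order-$(k+1)$
terms with exponent 1 remain. One more integration by parts raises the exponent to $2=-k+(k+2)$,
which is the remainder of order $k+2$ at $s=-k$. -/
lemma integral_scaledBernoulli_mul_digammaSeries (k : ℕ) :
    ∫ x in (0 : ℝ)..1, scaledBernoulli (k + 1) (1 - x) * digammaSeries x =
      (-1) ^ k * (emRemainder (k + 2) (-(k : ℂ)) -
        (bernoulli (k + 2) : ℂ) / ((k + 2).factorial : ℂ)) := by
  have h1 := hasSum_integral_mul_digammaSeries (continuous_scaledBernoulli (k + 1))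
  have h2 := (hasSum_emTerm_succ k (w := 1) (by simp)).neg
  have heq : ∀ n : ℕ, ∫ x in (0 : ℝ)..1, scaledBernoulli (k + 1) x *
      (1 / ((n : ℂ) + 1) - 1 / ((n : ℂ) + 1 + x)) = -emTerm (k + 1) n 1 := by
    intro n
    have i1 : IntervalIntegrable (fun x : ℝ => scaledBernoulli (k + 1) x * (1 / ((n : ℂ) + 1)))
        MeasureTheory.volume 0 1 :=
      ((continuous_scaledBernoulli (k + 1)).mul continuous_const).intervalIntegrable _ _
    have i2 : IntervalIntegrable (fun x : ℝ => scaledBernoulli (k + 1) x *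
        ((n + 1 + x : ℝ) : ℂ) ^ (-1 : ℂ)) MeasureTheory.volume 0 1 :=
      ((continuous_scaledBernoulli (k + 1)).continuousOn.mul
        (continuousOn_shift_cpow n 1)).intervalIntegrable
    have h3 := intervalIntegral.integral_sub i1 i2
    rw [intervalIntegral.integral_mul_const, integral_scaledBernoulli, zero_mul, zero_sub] at h3
    rw [emTerm, ← h3]
    refine intervalIntegral.integral_congr fun x _ => ?_
    simp only [Complex.cpow_neg_one]
    push_cast
    rw [mul_sub, one_div, one_div]
  simp_rw [heq] at h1
  have h4 := h1.unique h2
  have h5 : ∑' n : ℕ, emTerm (k + 2) n (1 + 1) = emRemainder (k + 2) (-(k : ℂ)) := by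
    rw [emRemainder]
    congr 2
    funext n
    congr 1
    push_cast
    ring
  rw [h5, one_mul] at h4
  simp_rw [scaledBernoulli_one_sub, mul_assoc]
  rw [intervalIntegral.integral_const_mul, h4, pow_succ]
  ring

/-- Termwise integration gives the partial sums $H_N-\log(N+1)$, which tend to $\gamma$. -/
lemma integral_digammaSeries :
    ∫ x in (0 : ℝ)..1, digammaSeries x = (Real.eulerMascheroniConstant : ℂ) := by
  have h1 := hasSum_integral_mul_digammaSeries (h := fun _ => 1) continuous_const
  have heq : ∀ n : ℕ, ∫ x in (0 : ℝ)..1, (1 : ℂ) * (1 / ((n : ℂ) + 1) - 1 / ((n : ℂ) + 1 + x)) =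
      ((1 / ((n : ℝ) + 1) - (Real.log (n + 2) - Real.log (n + 1)) : ℝ) : ℂ) := by
    intro n
    have hpos : ∀ x ∈ Set.uIcc (0 : ℝ) 1, (0 : ℝ) < n + 1 + x := fun x hx => by
      rw [Set.uIcc_of_le zero_le_one] at hx
      linarith [hx.1, (Nat.cast_nonneg n : (0 : ℝ) ≤ n)]
    have h2 := intervalIntegral.integral_eq_sub_of_hasDerivAt (a := (0 : ℝ)) (b := 1)
      (f := fun x : ℝ => x / ((n : ℝ) + 1) - Real.log (n + 1 + x))
      (f' := fun x : ℝ => 1 / ((n : ℝ) + 1) - 1 / (n + 1 + x))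
      (fun x hx => ((hasDerivAt_id x).div_const _).sub
        (((hasDerivAt_id x).const_add ((n : ℝ) + 1)).log (hpos x hx).ne'))
      (continuousOn_const.sub (continuousOn_const.div (by fun_prop)
        fun x hx => (hpos x hx).ne')).intervalIntegrable
    rw [show (1 / ((n : ℝ) + 1) - (Real.log (n + 2) - Real.log (n + 1)) : ℝ) =
      1 / ((n : ℝ) + 1) - Real.log (n + 1 + 1) - (0 / ((n : ℝ) + 1) - Real.log (n + 1 + 0)) by
        rw [show (n : ℝ) + 1 + 1 = n + 2 by ring, add_zero]; ring, ← h2,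
      ← intervalIntegral.integral_ofReal]
    refine intervalIntegral.integral_congr fun x _ => ?_
    push_cast
    ring
  simp_rw [heq, one_mul] at h1
  have hs : ∀ N : ℕ, ∑ n ∈ Finset.range N,
      ((1 / ((n : ℝ) + 1) - (Real.log (n + 2) - Real.log (n + 1)) : ℝ) : ℂ) =
      ((harmonic N - Real.log (N + 1) : ℝ) : ℂ) := by
    intro N
    rw [← Complex.ofReal_sum]
    congr 1
    induction N with
    | zero => simp
    | succ N ih =>
      rw [Finset.sum_range_succ, ih, harmonic_succ]
      push_cast
      rw [show (N : ℝ) + 1 + 1 = N + 2 by ring, one_div]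
      ring
  have hlim := h1.tendsto_sum_nat
  simp_rw [hs] at hlim
  exact tendsto_nhds_unique hlim
    ((Complex.continuous_ofReal.tendsto _).comp Real.tendsto_harmonic_sub_log_add_one)

/-! ### The generating function of the Bernoulli polynomials. -/

lemma summable_scaledBernoulli {z : ℝ} (hz0 : 0 < z) (hz : z < 2 * Real.pi) {x : ℝ}
    (hx : x ∈ Set.Icc (0 : ℝ) 1) : Summable fun n : ℕ => ‖scaledBernoulli n x * (z : ℂ) ^ n‖ := by
  have hpi := Real.pi_pos
  have hg : Summable fun n : ℕ => 4 * (z / (2 * Real.pi)) ^ n :=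
    (summable_geometric_of_lt_one (by positivity)
      ((div_lt_one (by positivity)).2 hz)).mul_left 4
  refine Summable.of_nonneg_of_le (fun _ => norm_nonneg _) (fun n => ?_) hg
  rw [norm_mul, norm_pow, Complex.norm_real, Real.norm_eq_abs, abs_of_pos hz0]
  calc _ ≤ 4 / (2 * Real.pi) ^ n * z ^ n := by gcongr; exact norm_scaledBernoulli_le n hx
    _ = _ := by rw [div_pow]; ring

/-- This is the coefficient of $t^n$ in the formal identity
$\bigl(\sum_kB_k(x)\frac{t^k}{k!}\bigr)(e^t-1)=te^{xt}$. -/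
lemma sum_antidiagonal_scaledBernoulli (n : ℕ) (x : ℝ) :
    ∑ p ∈ Finset.HasAntidiagonal.antidiagonal n, scaledBernoulli p.1 x *
      (if p.2 = 0 then 0 else 1 / (p.2.factorial : ℂ)) =
        if n = 0 then 0 else (x : ℂ) ^ (n - 1) / ((n - 1).factorial : ℂ) := by
  have h := congrArg (PowerSeries.coeff n) (Polynomial.bernoulli_generating_function (x : ℝ))
  rw [PowerSeries.coeff_mul] at h
  have h' := congrArg (fun r : ℝ => (r : ℂ)) h
  rw [Complex.ofReal_sum] at h'
  convert h' using 1
  · refine Finset.sum_congr rfl fun p _ => ?_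
    rw [PowerSeries.coeff_mk, map_sub, PowerSeries.coeff_exp, PowerSeries.coeff_one,
      Complex.ofReal_mul]
    congr 1
    · rw [scaledBernoulli, bernoulliFun, map_smul, Polynomial.eval_map_algebraMap, Rat.smul_def]
      push_cast
      ring
    · by_cases hp : p.2 = 0
      · simp [hp]
      · simp [hp]
  · cases n with
    | zero => simp
    | succ n =>
      rw [PowerSeries.coeff_succ_X_mul, PowerSeries.coeff_rescale, PowerSeries.coeff_exp]
      simp [div_eq_mul_inv]

lemma hasSum_scaledBernoulli {z : ℝ} (hz0 : 0 < z) (hz : z < 2 * Real.pi) {x : ℝ}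
    (hx : x ∈ Set.Icc (0 : ℝ) 1) :
    HasSum (fun n : ℕ => scaledBernoulli n x * (z : ℂ) ^ n)
      (z * Complex.exp (x * z) / (Complex.exp z - 1)) := by
  have hB := summable_scaledBernoulli hz0 hz hx
  have hexp : ∀ w : ℂ, HasSum (fun n : ℕ => w ^ n / (n.factorial : ℂ)) (Complex.exp w) := fun w => by
    rw [Complex.exp_eq_exp_ℂ]
    exact NormedSpace.expSeries_div_hasSum_exp w
  have hE : HasSum (fun n : ℕ => (if n = 0 then 0 else 1 / (n.factorial : ℂ)) * (z : ℂ) ^ n)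
      (Complex.exp z - 1) := by
    have h := (hexp z).sub (hasSum_ite_eq (0 : ℕ) (1 : ℂ))
    refine h.congr_fun fun n => ?_
    by_cases hn : n = 0
    · simp [hn]
    · simp [hn, div_eq_inv_mul]
  have hEn : Summable fun n : ℕ => ‖(if n = 0 then 0 else 1 / (n.factorial : ℂ)) * (z : ℂ) ^ n‖ :=
    hE.summable.norm
  -- Absolute convergence lets the Cauchy product carry the formal identity over to numbers; then
  -- $e^z-1\ne0$ is divided out.
  have hprod := tsum_mul_tsum_eq_tsum_sum_antidiagonal_of_summable_norm hB hEn
  have hR : HasSum (fun n : ℕ => ∑ p ∈ Finset.HasAntidiagonal.antidiagonal n, scaledBernoulli p.1 x * (z : ℂ) ^ p.1 *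
      ((if p.2 = 0 then 0 else 1 / (p.2.factorial : ℂ)) * (z : ℂ) ^ p.2))
      (z * Complex.exp (x * z)) := by
    have h1 := (hexp (x * z)).mul_left (z : ℂ)
    rw [← hasSum_nat_add_iff' 1]
    simp only [Finset.range_one, Finset.sum_singleton, Finset.HasAntidiagonal.antidiagonal_zero, if_true, zero_mul,
      mul_zero, sub_zero]
    refine h1.congr_fun fun n => ?_
    have h2 := sum_antidiagonal_scaledBernoulli (n + 1) x
    rw [if_neg n.succ_ne_zero, Nat.add_sub_cancel] at h2
    calc _ = (z : ℂ) ^ (n + 1) * ((x : ℂ) ^ n / (n.factorial : ℂ)) := by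
          rw [← h2, Finset.mul_sum]
          refine Finset.sum_congr rfl fun p hp => ?_
          rw [← Finset.HasAntidiagonal.mem_antidiagonal.1 hp, pow_add]
          ring
      _ = _ := by rw [mul_pow]; ring
  have hne : Complex.exp z - 1 ≠ 0 := by
    rw [sub_ne_zero, ← Complex.ofReal_exp]
    exact_mod_cast (Real.one_lt_exp_iff.2 hz0).ne'
  rw [hE.tsum_eq, hR.tsum_eq] at hprod
  rw [← hprod, mul_div_cancel_right₀ _ hne]
  exact (hB.of_norm).hasSum

/-- The moments of `digammaSeries` against the reflected Bernoulli polynomials. -/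
noncomputable def digammaMoment (k : ℕ) : ℂ :=
  ∫ x in (0 : ℝ)..1, scaledBernoulli k (1 - x) * digammaSeries x

/-- The generating function at $1-x$ is integrated termwise against $g$, using $|g|\le4$ on $[0,1]$.
-/
lemma hasSum_digammaMoment {z : ℝ} (hz0 : 0 < z) (hz : z < 2 * Real.pi) :
    HasSum (fun n : ℕ => (z : ℂ) ^ n * digammaMoment n)
      (z / (Complex.exp z - 1) *
        ∫ x in (0 : ℝ)..1, Complex.exp ((1 - x) * z) * digammaSeries x) := by
  have hpi := Real.pi_pos
  have hmem : ∀ x : ℝ, x ∈ Set.uIoc (0 : ℝ) 1 → x ∈ Set.Icc (0 : ℝ) 1 := fun x hx => by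
    rw [Set.uIoc_of_le zero_le_one] at hx
    exact ⟨hx.1.le, hx.2⟩
  have hsum : Summable fun n : ℕ => 4 * (z / (2 * Real.pi)) ^ n * 4 :=
    ((summable_geometric_of_lt_one (by positivity)
      ((div_lt_one (by positivity)).2 hz)).mul_left 4).mul_right 4
  have h := intervalIntegral.hasSum_integral_of_dominated_convergence (a := (0 : ℝ)) (b := 1)
    (μ := MeasureTheory.volume)
    (F := fun (n : ℕ) (x : ℝ) => (z : ℂ) ^ n * (scaledBernoulli n (1 - x) * digammaSeries x))
    (f := fun x : ℝ => z / (Complex.exp z - 1) * (Complex.exp ((1 - x) * z) * digammaSeries x))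
    (fun n _ => 4 * (z / (2 * Real.pi)) ^ n * 4) (fun n => ?_)
    (fun n => Eventually.of_forall fun x hx => ?_) (Eventually.of_forall fun x _ => hsum)
    intervalIntegrable_const (Eventually.of_forall fun x hx => ?_)
  · simp_rw [intervalIntegral.integral_const_mul] at h
    exact h
  · refine ContinuousOn.aestronglyMeasurable ?_ measurableSet_uIoc
    exact continuousOn_const.mul ((by fun_prop : Continuous fun x : ℝ =>
      scaledBernoulli n (1 - x)).continuousOn.mul
        (continuousOn_digammaSeries_uIcc.mono Set.uIoc_subset_uIcc))
  · obtain ⟨h0, h1⟩ := hmem x hx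
    have hg : ‖digammaSeries x‖ ≤ 4 := by
      refine (norm_digammaSeries_le (by simp; linarith)).trans ?_
      rw [Complex.norm_real, Real.norm_eq_abs, abs_of_nonneg h0]
      linarith
    rw [← mul_assoc, norm_mul, norm_mul, norm_pow, Complex.norm_real, Real.norm_eq_abs,
      abs_of_pos hz0]
    refine mul_le_mul ?_ hg (norm_nonneg _) (by positivity)
    calc _ ≤ z ^ n * (4 / (2 * Real.pi) ^ n) := by
          gcongr
          exact norm_scaledBernoulli_le n ⟨by linarith, by linarith⟩
      _ = _ := by rw [div_pow]; ring
  · obtain ⟨h0, h1⟩ := hmem x hx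
    have := (hasSum_scaledBernoulli hz0 hz (x := 1 - x) ⟨by linarith, by linarith⟩).mul_right
      (digammaSeries x)
    convert! this using 1
    · funext n
      ring
    · push_cast
      ring

lemma digammaMoment_zero : digammaMoment 0 = (Real.eulerMascheroniConstant : ℂ) := by
  rw [← integral_digammaSeries, digammaMoment]
  simp [scaledBernoulli]

/-! ### The Laplace transform of the Borel transform. -/

lemma integrableOn_exp_mul_digammaSeries {w : ℝ} (hw : 0 < w) :
    MeasureTheory.IntegrableOn (fun x : ℝ => Complex.exp (-(x * w : ℂ)) * digammaSeries x)
      (Set.Ioi 0) := by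
  have hdom : MeasureTheory.IntegrableOn (fun x : ℝ => 4 * (x ^ (1 : ℝ) * Real.exp (-w * x)))
      (Set.Ioi 0) := by
    have := integrableOn_rpow_mul_exp_neg_mul_rpow (s := 1) (p := 1) (b := w) (by norm_num)
      one_pos hw
    simpa [MeasureTheory.IntegrableOn] using this.const_mul 4
  refine hdom.mono' ?_ ?_
  · refine ContinuousOn.aestronglyMeasurable ?_ measurableSet_Ioi
    exact (by fun_prop : Continuous fun x : ℝ => Complex.exp (-(x * w : ℂ))).continuousOn.mul
      (continuousOn_digammaSeries.mono Set.Ioi_subset_Ici_self)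
  · refine (MeasureTheory.ae_restrict_iff' measurableSet_Ioi).2 (Eventually.of_forall fun x hx => ?_)
    have hx' : (0 : ℝ) < x := hx
    have hg := norm_digammaSeries_le (x := (x : ℂ)) (by simp; linarith)
    rw [Complex.norm_real, Real.norm_eq_abs, abs_of_pos hx'] at hg
    have he : ‖Complex.exp (-(x * w : ℂ))‖ = Real.exp (-w * x) := by
      rw [Complex.norm_exp]
      simp [mul_comm]
    rw [norm_mul, he, Real.rpow_one]
    calc _ ≤ Real.exp (-w * x) * (4 * x) := by gcongr
      _ = _ := by ring

lemma hasLaplaceIntegral_digammaSeries {w : ℝ} (hw : 0 < w) :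
    HasLaplaceIntegral digammaSeries w (laplaceTransform (fun x => digammaSeries x) w) :=
  MeasureTheory.intervalIntegral_tendsto_integral_Ioi 0
    (integrableOn_exp_mul_digammaSeries hw) tendsto_id

lemma integrableOn_exp_mul_one_div {z : ℝ} (hz : 0 < z) :
    MeasureTheory.IntegrableOn
      (fun x : ℝ => Complex.exp (-(x * z : ℂ)) * (1 / ((x : ℂ) + 1))) (Set.Ioi 0) := by
  have hpos : ∀ x : ℝ, x ∈ Set.Ioi (0 : ℝ) → (1 : ℝ) ≤ x + 1 := fun x hx => by
    have : (0 : ℝ) < x := hx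
    linarith
  refine (integrableOn_exp_mul_Ioi (a := -z) (by linarith) 0).mono' ?_ ?_
  · refine ContinuousOn.aestronglyMeasurable ?_ measurableSet_Ioi
    refine (by fun_prop : Continuous fun x : ℝ => Complex.exp (-(x * z : ℂ))).continuousOn.mul
      (continuousOn_const.div (by fun_prop) fun x hx => ?_)
    exact_mod_cast (by linarith [hpos x hx] : x + 1 ≠ 0)
  · refine (MeasureTheory.ae_restrict_iff' measurableSet_Ioi).2 (Eventually.of_forall fun x hx => ?_)
    have he : ‖Complex.exp (-(x * z : ℂ))‖ = Real.exp (-z * x) := by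
      rw [Complex.norm_exp]
      simp [mul_comm]
    have h1 : ‖(x : ℂ) + 1‖ = x + 1 := by
      rw [← Complex.ofReal_one, ← Complex.ofReal_add, Complex.norm_real, Real.norm_eq_abs,
        abs_of_nonneg (by linarith [hpos x hx])]
    rw [norm_mul, he, norm_div, norm_one, h1]
    refine mul_le_of_le_one_right (Real.exp_pos _).le ?_
    rw [div_le_one (by linarith [hpos x hx])]
    exact hpos x hx

/-- The transform of $g(x+1)$ is computed twice: by the functional equation (`h1`), and by
translation, which leaves $e^z$ times the integral over $(1,\infty)$ (`h2`). The piece over $[0,1]$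
is the difference. -/
lemma laplaceTransform_digammaSeries {z : ℝ} (hz : 0 < z) :
    (Complex.exp z - 1) * laplaceTransform (fun x => digammaSeries x) z =
      laplaceTransform (fun x : ℝ => 1 / ((x : ℂ) + 1)) z +
        ∫ x in (0 : ℝ)..1, Complex.exp ((1 - x) * z) * digammaSeries x := by
  have hI := integrableOn_exp_mul_digammaSeries hz
  have h1 : ∫ x in Set.Ioi (0 : ℝ), Complex.exp (-(x * z : ℂ)) * digammaSeries ((x + 1 : ℝ) : ℂ) =
      laplaceTransform (fun x => digammaSeries x) z +
        laplaceTransform (fun x : ℝ => 1 / ((x : ℂ) + 1)) z := by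
    rw [laplaceTransform, laplaceTransform,
      ← MeasureTheory.integral_add hI (integrableOn_exp_mul_one_div hz)]
    refine MeasureTheory.setIntegral_congr_fun measurableSet_Ioi fun x hx => ?_
    have hx' : (0 : ℝ) < x := hx
    rw [Complex.ofReal_add, Complex.ofReal_one, digammaSeries_add_one (by simpa using hx'.le)]
    ring
  have h2 : ∫ x in Set.Ioi (0 : ℝ), Complex.exp (-(x * z : ℂ)) * digammaSeries ((x + 1 : ℝ) : ℂ) =
      Complex.exp z * ∫ x in Set.Ioi (1 : ℝ), Complex.exp (-(x * z : ℂ)) * digammaSeries x := by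
    have h := (MeasureTheory.measurePreserving_add_right MeasureTheory.volume
      (1 : ℝ)).setIntegral_preimage_emb (measurableEmbedding_addRight 1)
      (fun x : ℝ => Complex.exp (-(x * z : ℂ)) * digammaSeries x) (Set.Ioi 1)
    rw [Set.preimage_add_const_Ioi, sub_self] at h
    rw [← h, ← MeasureTheory.integral_const_mul]
    refine MeasureTheory.integral_congr_ae (Eventually.of_forall fun x => ?_)
    beta_reduce
    rw [← mul_assoc, ← Complex.exp_add]
    congr 2
    push_cast
    ring
  have h3 : laplaceTransform (fun x => digammaSeries x) z =
      (∫ x in (0 : ℝ)..1, Complex.exp (-(x * z : ℂ)) * digammaSeries x) +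
        ∫ x in Set.Ioi (1 : ℝ), Complex.exp (-(x * z : ℂ)) * digammaSeries x :=
    (intervalIntegral.integral_interval_add_Ioi hI
      (hI.mono_set (Set.Ioi_subset_Ioi zero_le_one))).symm
  have h4 : ∫ x in (0 : ℝ)..1, Complex.exp ((1 - x) * z) * digammaSeries x =
      Complex.exp z * ∫ x in (0 : ℝ)..1, Complex.exp (-(x * z : ℂ)) * digammaSeries x := by
    rw [← intervalIntegral.integral_const_mul]
    refine intervalIntegral.integral_congr fun x _ => ?_
    rw [← mul_assoc, ← Complex.exp_add]
    congr 2
    ring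
  rw [h4]
  linear_combination h1 - h2 + Complex.exp z * h3

/-! ### Comparison of the coefficients of $z^k$. -/

lemma sum_Icc_one_eq_sum_range {M : Type*} [AddCommMonoid M] (f : ℕ → M) (k : ℕ) :
    ∑ m ∈ Finset.Icc 1 k, f m = ∑ i ∈ Finset.range k, f (i + 1) := by
  induction k with
  | zero => simp
  | succ k ih => rw [Finset.sum_Icc_succ_top (by omega), ih, Finset.sum_range_succ]

lemma neg_one_pow_mul_bernoulli (j : ℕ) : (-1 : ℚ) ^ j * bernoulli (j + 2) = bernoulli (j + 2) := by
  rcases Nat.even_or_odd j with h | h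
  · rw [h.neg_one_pow, one_mul]
  · rw [bernoulli_eq_zero_of_odd (h.add_even even_two) (by omega), mul_zero]

/-- This is the recurrence $\sum_{j<n}\binom njB_j=0$ for $n=d+2$, with the terms $B_0$ and $B_1$
moved to the right. It evaluates the total coefficient of $H_k$. -/
lemma sum_bernoulli_div_factorial (d : ℕ) :
    ∑ j ∈ Finset.range d, (bernoulli (j + 2) : ℂ) / ((j + 2).factorial : ℂ) /
      ((d - j).factorial : ℂ) = ((d + 2 : ℂ) / 2 - 1) / ((d + 2).factorial : ℂ) := by
  have h := sum_bernoulli (d + 2)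
  rw [if_neg (by omega), Finset.sum_range_succ', Finset.sum_range_succ'] at h
  have hf : ((d + 2).factorial : ℂ) ≠ 0 := by exact_mod_cast (d + 2).factorial_ne_zero
  rw [eq_div_iff hf, Finset.sum_mul]
  have h' := congrArg (fun q : ℚ => (q : ℂ)) h
  simp only [Rat.cast_add, Rat.cast_sum, Rat.cast_mul, Rat.cast_natCast, Rat.cast_zero, zero_add,
    Nat.choose_zero_right, Nat.choose_one_right, bernoulli_zero, bernoulli_one] at h'
  push_cast at h'
  have h2 : ∀ j ∈ Finset.range d, (bernoulli (j + 2) : ℂ) / ((j + 2).factorial : ℂ) /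
      ((d - j).factorial : ℂ) * ((d + 2).factorial : ℂ) =
        ((d + 2).choose (j + 1 + 1) : ℂ) * (bernoulli (j + 1 + 1) : ℂ) := by
    intro j hj
    have hj' : j + 2 ≤ d + 2 := by
      have := Finset.mem_range.1 hj
      omega
    rw [Nat.cast_choose ℂ hj', show d + 2 - (j + 2) = d - j by omega]
    have h3 : ((j + 2).factorial : ℂ) ≠ 0 := by exact_mod_cast (j + 2).factorial_ne_zero
    have h4 : ((d - j).factorial : ℂ) ≠ 0 := by exact_mod_cast (d - j).factorial_ne_zero
    field_simp
  rw [Finset.sum_congr rfl h2]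
  linear_combination h'

lemma deriv_riemannZeta_neg_add_digammaMoment (k : ℕ) :
    1 / (k.factorial : ℂ) * deriv riemannZeta (-(k : ℂ)) + digammaMoment (k + 1) =
      -(1 / ((k + 1).factorial : ℂ) * (1 / ((k : ℂ) + 1)))
      - (∑ m ∈ Finset.Icc 1 k, (bernoulli m : ℂ) / (m.factorial : ℂ) *
          ((harmonic (k - m + 1) : ℂ) / ((k - m + 1).factorial : ℂ)))
      - 1 / (k.factorial : ℂ) * (harmonic k : ℂ) *
          ((1 - (bernoulli (k + 1) : ℂ)) / ((k : ℂ) + 1)) := by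
  have hk : (k.factorial : ℂ) ≠ 0 := by exact_mod_cast k.factorial_ne_zero
  have hk1 : (k : ℂ) + 1 ≠ 0 := by exact_mod_cast k.succ_ne_zero
  have hsum : (∑ j ∈ Finset.range k, (bernoulli (j + 2) : ℂ) / ((j + 2).factorial : ℂ) *
        ((-1) ^ j * (k.factorial : ℂ) / ((k - (j + 1)).factorial : ℂ) *
          ((harmonic k : ℂ) - (harmonic (k - (j + 1)) : ℂ)))) =
      (k.factorial : ℂ) * ∑ j ∈ Finset.range k, (bernoulli (j + 2) : ℂ) / ((j + 2).factorial : ℂ) /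
        ((k - (j + 1)).factorial : ℂ) * ((harmonic k : ℂ) - (harmonic (k - (j + 1)) : ℂ)) := by
    rw [Finset.mul_sum]
    refine Finset.sum_congr rfl fun j _ => ?_
    have h : (-1 : ℂ) ^ j * (bernoulli (j + 2) : ℂ) = (bernoulli (j + 2) : ℂ) := by
      exact_mod_cast congrArg (fun q : ℚ => (q : ℂ)) (neg_one_pow_mul_bernoulli j)
    linear_combination (k.factorial : ℂ) / ((j + 2).factorial : ℂ) /
      ((k - (j + 1)).factorial : ℂ) * ((harmonic k : ℂ) - (harmonic (k - (j + 1)) : ℂ)) * h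
  rw [deriv_riemannZeta_neg, digammaMoment, integral_scaledBernoulli_mul_digammaSeries, hsum]
  -- Here the remainder `R` and the boundary term `b` cancel between $\zeta'(-k)/k!$ and the moment.
  have hred : ∀ A b R : ℂ, 1 / (k.factorial : ℂ) * (-1 / ((k : ℂ) + 1) ^ 2 +
      (k.factorial : ℂ) * A + (-1) ^ k * (k.factorial : ℂ) * (b - R)) + (-1) ^ k * (R - b) =
      -(1 / ((k + 1).factorial : ℂ) * (1 / ((k : ℂ) + 1))) + A := by
    intro A b R
    rw [Nat.factorial_succ]
    push_cast
    field_simp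
    ring
  rw [hred]
  cases k with
  | zero => simp
  | succ d =>
    have hd : ((d + 1).factorial : ℂ) ≠ 0 := hk
    have hd1 : (d : ℂ) + 1 + 1 ≠ 0 := by exact_mod_cast hk1
    -- With $m=j+2$ the two sums match except at the ends: $j=d$ carries $B_{k+1}$ with $H_0=0$, and
    -- $m=1$ carries $B_1=-\frac12$, which absorbs the $\frac{d+2}2$ of `hP`.
    rw [Finset.sum_range_succ, sum_Icc_one_eq_sum_range, Finset.sum_range_succ']
    have hP := sum_bernoulli_div_factorial d
    have hidx : ∀ j ∈ Finset.range d, (bernoulli (j + 1 + 1) : ℂ) / ((j + 1 + 1).factorial : ℂ) *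
        ((harmonic (d + 1 - (j + 1 + 1) + 1) : ℂ) / ((d + 1 - (j + 1 + 1) + 1).factorial : ℂ)) =
        (bernoulli (j + 2) : ℂ) / ((j + 2).factorial : ℂ) / ((d - j).factorial : ℂ) *
          (harmonic (d - j) : ℂ) := by
      intro j hj
      have := Finset.mem_range.1 hj
      rw [show d + 1 - (j + 1 + 1) + 1 = d - j by omega]
      ring
    rw [Finset.sum_congr rfl hidx]
    have hidx2 : ∀ j : ℕ, d + 1 - (j + 1) = d - j := fun j => by omega
    simp only [hidx2, Nat.sub_self, mul_sub, Finset.sum_sub_distrib, ← Finset.sum_mul, hP,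
      harmonic_zero, Rat.cast_zero, zero_add, bernoulli_one, Nat.sub_zero]
    rw [show (d + 2).factorial = (d + 1 + 1) * (d + 1).factorial from Nat.factorial_succ _]
    push_cast
    simp only [Nat.factorial_zero, Nat.factorial_one, Nat.cast_one]
    field_simp
    ring

/-! ### Convergence of the series in $k$. -/

lemma norm_harmonic_le (n : ℕ) : ‖(harmonic n : ℂ)‖ ≤ n := by
  induction n with
  | zero => simp
  | succ n ih =>
    rw [harmonic_succ]
    push_cast
    refine (norm_add_le _ _).trans (add_le_add ih ?_)
    rw [norm_inv, ← Nat.cast_add_one, Complex.norm_natCast]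
    exact inv_le_one_of_one_le₀ (by exact_mod_cast Nat.succ_pos n)

lemma summable_pow_div_factorial_mul_one_div (z : ℂ) :
    Summable fun k : ℕ => z ^ k / ((k + 1).factorial : ℂ) * (1 / ((k : ℂ) + 1)) := by
  refine Summable.of_norm_bounded (Real.summable_pow_div_factorial ‖z‖) fun k => ?_
  rw [norm_mul, norm_div, norm_div, norm_one, norm_pow, ← Nat.cast_add_one, Complex.norm_natCast,
    Complex.norm_natCast]
  refine (mul_le_of_le_one_right (by positivity) ?_).trans ?_
  · rw [div_le_one (by positivity)]
    exact_mod_cast Nat.succ_pos k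
  · gcongr
    exact Nat.le_succ k

lemma norm_bernoulli_div_factorial_le (m : ℕ) :
    ‖(bernoulli m : ℂ) / (m.factorial : ℂ)‖ ≤ 4 / (2 * Real.pi) ^ m := by
  rw [← scaledBernoulli_eval_zero]
  exact norm_scaledBernoulli_le m ⟨le_rfl, zero_le_one⟩

/-- The series is the Cauchy product of $\sum_{m\ge1}\frac{B_m}{m!}z^m$ and
$\sum_n\frac{H_{n+1}}{(n+1)!}z^n$, both absolutely convergent. -/
lemma summable_bernoulli_mul_harmonic {z : ℝ} (hz0 : 0 < z) (hz : z < 2 * Real.pi) :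
    Summable fun k : ℕ => (z : ℂ) ^ k * ∑ m ∈ Finset.Icc 1 k,
      (bernoulli m : ℂ) / (m.factorial : ℂ) *
        ((harmonic (k - m + 1) : ℂ) / ((k - m + 1).factorial : ℂ)) := by
  have h1 : Summable fun n : ℕ => ‖(if n = 0 then 0 else
      (bernoulli n : ℂ) / (n.factorial : ℂ)) * (z : ℂ) ^ n‖ := by
    refine Summable.of_nonneg_of_le (fun _ => norm_nonneg _) (fun n => ?_)
      (summable_scaledBernoulli hz0 hz (x := 0) ⟨le_rfl, zero_le_one⟩)
    rw [scaledBernoulli_eval_zero]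
    split_ifs with h
    · rw [zero_mul, norm_zero]
      exact norm_nonneg _
    · rfl
  have h2 : Summable fun n : ℕ =>
      ‖(harmonic (n + 1) : ℂ) / ((n + 1).factorial : ℂ) * (z : ℂ) ^ n‖ := by
    refine Summable.of_nonneg_of_le (fun _ => norm_nonneg _) (fun n => ?_)
      (Real.summable_pow_div_factorial z)
    rw [norm_mul, norm_div, norm_pow, Complex.norm_natCast, Complex.norm_real, Real.norm_eq_abs,
      abs_of_pos hz0, Nat.factorial_succ]
    have := norm_harmonic_le (n + 1)
    calc _ ≤ ((n + 1 : ℕ) : ℝ) / (((n + 1) * n.factorial : ℕ) : ℝ) * z ^ n := by gcongr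
      _ = _ := by
        push_cast
        field_simp
  refine (summable_norm_sum_mul_antidiagonal_of_summable_norm h1 h2).of_norm.congr fun k => ?_
  rw [Finset.Nat.sum_antidiagonal_eq_sum_range_succ (fun i j =>
    (if i = 0 then 0 else (bernoulli i : ℂ) / (i.factorial : ℂ)) * (z : ℂ) ^ i *
      ((harmonic (j + 1) : ℂ) / ((j + 1).factorial : ℂ) * (z : ℂ) ^ j)), Finset.sum_range_succ',
    sum_Icc_one_eq_sum_range, Finset.mul_sum]
  simp only [if_true, zero_mul, add_zero]
  refine Finset.sum_congr rfl fun i hi => ?_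
  rw [if_neg i.succ_ne_zero]
  have h3 : (z : ℂ) ^ k = (z : ℂ) ^ (i + 1) * (z : ℂ) ^ (k - (i + 1)) := by
    rw [← pow_add, Nat.add_sub_cancel' (Finset.mem_range.1 hi)]
  rw [h3]
  ring

lemma summable_harmonic_mul_one_sub_bernoulli {z : ℝ} (hz0 : 0 < z) (hz : z < 2 * Real.pi) :
    Summable fun k : ℕ => (z : ℂ) ^ (k + 1) / ((k + 1).factorial : ℂ) * (harmonic (k + 1) : ℂ) *
      ((1 - (bernoulli (k + 2) : ℂ)) / ((k : ℂ) + 2)) := by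
  have hpi := Real.pi_pos
  have h1 : Summable fun k : ℕ => z ^ (k + 1) / ((k + 1).factorial : ℝ) :=
    (summable_nat_add_iff 1).2 (Real.summable_pow_div_factorial z)
  have hr : ‖z / (2 * Real.pi)‖ < 1 := by
    rw [Real.norm_eq_abs, abs_of_pos (by positivity), div_lt_one (by positivity)]
    exact hz
  have h2 : Summable fun k : ℕ => 4 / (2 * Real.pi) *
      (((k + 1 : ℕ) : ℝ) ^ 1 * (z / (2 * Real.pi)) ^ (k + 1)) :=
    ((summable_nat_add_iff (f := fun k : ℕ => (k : ℝ) ^ 1 * (z / (2 * Real.pi)) ^ k) 1).2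
      (summable_pow_mul_geometric_of_norm_lt_one 1 hr)).mul_left _
  refine Summable.of_norm_bounded (h1.add h2) fun k => ?_
  have hH := norm_harmonic_le (k + 1)
  have hB := norm_bernoulli_div_factorial_le (k + 2)
  have hk2 : (k : ℂ) + 2 ≠ 0 := by exact_mod_cast (k + 1).succ_ne_zero
  have hkf : ((k + 1).factorial : ℂ) ≠ 0 := by exact_mod_cast (k + 1).factorial_ne_zero
  have hz' : ‖(z : ℂ)‖ = z := by rw [Complex.norm_real, Real.norm_eq_abs, abs_of_pos hz0]
  -- The first part is dominated by the exponential series. In the second, $k+2$ merges with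
  -- $(k+1)!$, so $B_{k+2}/(k+2)!$ gives a majorant of the form $k\,(z/2\pi)^k$ up to a constant and
  -- a shift.
  have hsplit : (z : ℂ) ^ (k + 1) / ((k + 1).factorial : ℂ) * (harmonic (k + 1) : ℂ) *
      ((1 - (bernoulli (k + 2) : ℂ)) / ((k : ℂ) + 2)) =
      (z : ℂ) ^ (k + 1) / ((k + 1).factorial : ℂ) * ((harmonic (k + 1) : ℂ) / ((k + 2 : ℕ) : ℂ)) -
      (harmonic (k + 1) : ℂ) * (z : ℂ) ^ (k + 1) *
        ((bernoulli (k + 2) : ℂ) / ((k + 2).factorial : ℂ)) := by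
    rw [show (k + 2).factorial = (k + 2) * (k + 1).factorial from Nat.factorial_succ _]
    push_cast
    field_simp
  rw [hsplit]
  refine (norm_sub_le _ _).trans (add_le_add ?_ ?_)
  · rw [norm_mul, norm_div, norm_div, norm_pow, hz', Complex.norm_natCast, Complex.norm_natCast]
    refine mul_le_of_le_one_right (by positivity) ?_
    rw [div_le_one (by positivity)]
    refine hH.trans ?_
    exact_mod_cast Nat.le_succ _
  · rw [norm_mul, norm_mul, norm_pow, hz']
    calc _ ≤ ((k + 1 : ℕ) : ℝ) * z ^ (k + 1) * (4 / (2 * Real.pi) ^ (k + 2)) := by gcongr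
      _ = _ := by
        rw [div_pow, pow_succ _ (k + 1), pow_one]
        field_simp

/-! ### The theorem. -/

theorem theorem2 (z : ℝ) (hz0 : 0 < z) (hzpi : z < Real.pi) :
    -- all the series converge, and so does the integral of the Laplace transform
    (Summable fun k : ℕ =>
      (z : ℂ) ^ k / (Nat.factorial k : ℂ) * deriv riemannZeta (-(k : ℂ))) ∧
    (Summable fun k : ℕ =>
      (z : ℂ) ^ k / (Nat.factorial (k + 1) : ℂ) * (1 / ((k : ℂ) + 1))) ∧
    (Summable fun k : ℕ =>
      (z : ℂ) ^ k * ∑ m ∈ Finset.Icc 1 k,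
        (bernoulli m : ℂ) / (Nat.factorial m : ℂ) *
          ((harmonic (k - m + 1) : ℂ) / (Nat.factorial (k - m + 1) : ℂ))) ∧
    (Summable fun k : ℕ =>
      (z : ℂ) ^ (k + 1) / (Nat.factorial (k + 1) : ℂ) * (harmonic (k + 1) : ℂ) *
        ((1 - (bernoulli (k + 2) : ℂ)) / ((k : ℂ) + 2))) ∧
    (MeasureTheory.IntegrableOn
      (fun x : ℝ => Complex.exp (-(x * z : ℂ)) * (1 / ((x : ℂ) + 1))) (Set.Ioi 0)) ∧
    -- the series over `n ≥ 1` is Borel summable, with Borel sum `S`, and the identity holds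
    ∃ S : ℂ,
      HasBorelSum
        (fun n : ℕ => if n = 0 then 0 else
          (-1) ^ (n + 1) * (Nat.factorial n : ℂ) * riemannZeta ((n : ℂ) + 1)) z S ∧
      (∑' k : ℕ, (z : ℂ) ^ k / (Nat.factorial k : ℂ) * deriv riemannZeta (-(k : ℂ)))
          - (Real.eulerMascheroniConstant : ℂ) / (z : ℂ) + S =
        1 / (Complex.exp z - 1) * laplaceTransform (fun x : ℝ => 1 / ((x : ℂ) + 1)) z
          - (∑' k : ℕ, (z : ℂ) ^ k / (Nat.factorial (k + 1) : ℂ) * (1 / ((k : ℂ) + 1)))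
          - (∑' k : ℕ, (z : ℂ) ^ k * ∑ m ∈ Finset.Icc 1 k,
              (bernoulli m : ℂ) / (Nat.factorial m : ℂ) *
                ((harmonic (k - m + 1) : ℂ) / (Nat.factorial (k - m + 1) : ℂ)))
          - (∑' k : ℕ, (z : ℂ) ^ (k + 1) / (Nat.factorial (k + 1) : ℂ) *
              (harmonic (k + 1) : ℂ) *
                ((1 - (bernoulli (k + 2) : ℂ)) / ((k : ℂ) + 2))) := by
  have hz2 : z < 2 * Real.pi := by linarith [Real.pi_pos]
  have hzc : (z : ℂ) ≠ 0 := by exact_mod_cast hz0.ne'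
  have hne : Complex.exp z - 1 ≠ 0 := by
    rw [sub_ne_zero, ← Complex.ofReal_exp]
    exact_mod_cast (Real.one_lt_exp_iff.2 hz0).ne'
  have hS1 := summable_pow_div_factorial_mul_one_div (z : ℂ)
  have hS2 := summable_bernoulli_mul_harmonic hz0 hz2
  have hS3 := summable_harmonic_mul_one_sub_bernoulli hz0 hz2
  -- The moment of index 0 is removed and the rest divided by $z$; the removed term becomes
  -- $\gamma/z$.
  have hM := ((hasSum_nat_add_iff' 1).2 (hasSum_digammaMoment hz0 hz2)).mul_left (1 / (z : ℂ))
  simp only [Finset.range_one, Finset.sum_singleton, pow_zero, one_mul, digammaMoment_zero] at hM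
  -- The term $k=0$ vanishes because $H_0=0$, so this series has the same sum as the shifted one in
  -- the statement.
  have h3 : HasSum (fun k : ℕ => (z : ℂ) ^ k / (k.factorial : ℂ) * (harmonic k : ℂ) *
      ((1 - (bernoulli (k + 1) : ℂ)) / ((k : ℂ) + 1)))
      (∑' k : ℕ, (z : ℂ) ^ (k + 1) / ((k + 1).factorial : ℂ) * (harmonic (k + 1) : ℂ) *
        ((1 - (bernoulli (k + 2) : ℂ)) / ((k : ℂ) + 2))) := by
    rw [← hasSum_nat_add_iff' 1]
    simp only [Finset.range_one, Finset.sum_singleton, harmonic_zero, Rat.cast_zero, mul_zero,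
      zero_mul, sub_zero]
    refine hS3.hasSum.congr_fun fun k => ?_
    push_cast
    rw [show (k : ℂ) + 1 + 1 = k + 2 by ring]
  -- Convergence of the series of $\zeta'(-k)$ needs no estimate of $\zeta'$: the coefficient
  -- identity writes it as a combination of four convergent series.
  have hA : HasSum (fun k : ℕ => (z : ℂ) ^ k / (k.factorial : ℂ) * deriv riemannZeta (-(k : ℂ))) _ :=
    (((hS1.hasSum.neg.sub hS2.hasSum).sub h3).sub hM).congr_fun fun k => by
      have h := deriv_riemannZeta_neg_add_digammaMoment k
      have hcancel : 1 / (z : ℂ) * ((z : ℂ) ^ (k + 1) * digammaMoment (k + 1)) =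
          (z : ℂ) ^ k * digammaMoment (k + 1) := by
        rw [pow_succ]
        field_simp
      rw [hcancel]
      linear_combination (z : ℂ) ^ k * h
  refine ⟨hA.summable, hS1, hS2, hS3, integrableOn_exp_mul_one_div hz0,
    laplaceTransform (fun x => digammaSeries x) z,
    ⟨digammaSeries, isBorelTransform_digammaSeries,
      fun w hw => ⟨_, hasLaplaceIntegral_digammaSeries hw⟩, hasLaplaceIntegral_digammaSeries hz0⟩, ?_⟩
  have hG := laplaceTransform_digammaSeries hz0
  have hG' : laplaceTransform (fun x => digammaSeries x) z =
      1 / (Complex.exp z - 1) * (laplaceTransform (fun x : ℝ => 1 / ((x : ℂ) + 1)) z +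
        ∫ x in (0 : ℝ)..1, Complex.exp ((1 - x) * z) * digammaSeries x) := by
    rw [← hG]
    field_simp
  rw [hA.tsum_eq, hG']
  field_simp
  ring
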